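/- Let $d\ge 1$, $s\in(0,1)$, and let $\Omega\subset\mathbb R^d$ be a bounded Lipschitz domain. For smooth compactly supported $w:\mathbb R^d\to\mathbb R$ let $$\mathbf{grad}^s w(x)=\mu(d,s)\int_{\mathbb R^d}\frac{w(y)-w(x)}{|x-y|^{d+s}}\,\frac{y-x}{|x-y|}\,dy,\qquad \mu(d,s)=\frac{2^s\,\Gamma(\frac{d+s+1}{2})}{\pi^{d/2}\,\Gamma(\frac{1-s}{2})}.$$ For $\Psi\in L^2(\mathbb R^d)^d$, the restriction $(\mathrm{div}^s\Psi)|_\Omega$ is understood in the sense of distributions: it is the function $g\in L^2(\Omega)$, if there is one, with $\int_{\mathbb R^d}\mathbf{grad}^s\varphi\cdot\Psi=-\int_\Omega\varphi\, g$ for all $\varphi\in C_c^\infty(\Omega)$. Let $H(\mathrm{div}^s;\Omega)$ be the space of all $\Psi\in L^2(\mathbb R^d)^d$ with $(\mathrm{div}^s\Psi)|_\Omega\in L^2(\Omega)$, normed by $$\|\Psi\|_{H(\mathrm{div}^s;\Omega)}=\big(\|\Psi\|_{L^2(\mathbb R^d)}^2+\|(\mathrm{div}^s\Psi)|_\Omega\|_{L^2(\Omega)}^2\big)^{1/2},$$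 and let $\widetilde L^2(\Omega)$ be the space of functions in $L^2(\Omega)$ extended by zero to $\mathbb R^d\setminus\Omega$. Set $$|w|_{H^s(\mathbb R^d)}^2=\frac{\nu(d,s)}{2}\iint_{\mathbb R^d\times\mathbb R^d}\frac{|w(x)-w(y)|^2}{|x-y|^{d+2s}}\,dx\,dy,\qquad \nu(d,s)=\frac{2^{2s}\,s\,\Gamma(s+\frac d2)}{\pi^{d/2}\,\Gamma(1-s)},$$ and let $\widetilde H^s(\Omega)$ be the space of $w\in L^2(\mathbb R^d)$ with $|w|_{H^s(\mathbb R^d)}<\infty$ and $\operatorname{supp}w\subset\overline\Omega$. There is a constant $C_P\ge 0$ for which the Poincaré inequality $$\|w\|_{L^2(\Omega)}\le C_P\,|w|_{H^s(\mathbb R^d)}\qquad\text{for all } w\in\widetilde H^s(\Omega)$$ holds. For every $f\in L^2(\Omega)$ there is a unique $(p,\Phi)\in\widetilde L^2(\Omega)\times H(\mathrm{div}^s;\Omega)$ such that $$\int_{\mathbb R^d}\Phi\cdot\Psi-\int_\Omega p\,\mathrm{div}^s\Psi+\int_\Omega q\,\mathrm{div}^s\Phi=\int_\Omega f q\qquad\text{for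 all }(q,\Psi)\in\widetilde L^2(\Omega)\times H(\mathrm{div}^s;\Omega).$$ Moreover, for every constant $C_P\ge 0$ for which the Poincaré inequality holds, $$\|p\|_{L^2(\Omega)}\le 2(1+C_P^2)\,\|f\|_{L^2(\Omega)},\qquad \|\Phi\|_{H(\mathrm{div}^s;\Omega)}\le 2\sqrt{1+C_P^2}\,\|f\|_{L^2(\Omega)}.$$ -/

import Mathlib

open MeasureTheory

open scoped ContDiff ENNReal

namespace FracDarcy

/-- The Euclidean space `ℝ^d`. -/
abbrev E (d : ℕ) : Type := EuclideanSpace ℝ (Fin d)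

/-- Scalar square-integrable functions on `ℝ^d` (a.e. classes). -/
abbrev L2 (d : ℕ) : Type := Lp ℝ 2 (volume : Measure (E d))

/-- Square-integrable vector fields on `ℝ^d` (a.e. classes). -/
abbrev L2Vec (d : ℕ) : Type := Lp (E d) 2 (volume : Measure (E d))

/-- Square-integrable functions on `Ω` (a.e. classes). -/
abbrev L2On {d : ℕ} (Ω : Set (E d)) : Type := Lp ℝ 2 (volume.restrict Ω)

/-- Near each boundary point, in suitable orthogonal coordinates with vertical unit vector `e`,
the set `Ω` is the region strictly above the graph of a Lipschitz function `γ`. The function `γ` is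
only evaluated at the horizontal part `y - ⟪e, y⟫ e` of a point `y`. -/
def HasLipschitzBoundary {d : ℕ} (Ω : Set (E d)) : Prop :=
  ∀ x ∈ frontier Ω, ∃ (e : E d) (γ : E d → ℝ) (K : NNReal) (r : ℝ),
    ‖e‖ = 1 ∧ LipschitzWith K γ ∧ 0 < r ∧
      ∀ y ∈ Metric.ball x r, y ∈ Ω ↔ γ (y - inner ℝ e y • e) < inner ℝ e y

/-- The normalization constant `ν(d,s)` of the fractional Laplacian. -/
noncomputable def nu (d : ℕ) (s : ℝ) : ℝ :=
  (2 : ℝ) ^ (2 * s) * s * Real.Gamma (s + d / 2) /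
    (Real.pi ^ ((d : ℝ) / 2) * Real.Gamma (1 - s))

/-- The normalization constant `μ(d,s)` of the fractional gradient. -/
noncomputable def mu (d : ℕ) (s : ℝ) : ℝ :=
  (2 : ℝ) ^ s * Real.Gamma ((d + s + 1) / 2) /
    (Real.pi ^ ((d : ℝ) / 2) * Real.Gamma ((1 - s) / 2))

/-- The fractional gradient of order `s ∈ (0,1)`,
`μ(d,s) ∫ (w(y) - w(x)) / |x-y|^(d+s) * (y-x) / |x-y| dy`. -/
noncomputable def fracGrad {d : ℕ} (s : ℝ) (w : E d → ℝ) (x : E d) : E d :=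
  mu d s • ∫ y, ((w y - w x) / ‖x - y‖ ^ ((d : ℝ) + s)) • (‖x - y‖⁻¹ • (y - x))

/-- Test functions on `Ω`: the space `C_c^∞(Ω)`. -/
def IsTestFunction {d : ℕ} (Ω : Set (E d)) (φ : E d → ℝ) : Prop :=
  ContDiff ℝ ∞ φ ∧ HasCompactSupport φ ∧ tsupport φ ⊆ Ω

/-- `g` is the restriction to `Ω` of the fractional divergence of `Ψ`, in the sense of
distributions on `Ω`. -/
def IsFracDivOn {d : ℕ} (s : ℝ) (Ω : Set (E d)) (Ψ : L2Vec d) (g : L2On Ω) : Prop :=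
  ∀ φ : E d → ℝ, IsTestFunction Ω φ →
    ∫ x, inner ℝ (fracGrad s φ x) (Ψ x) = -∫ x in Ω, φ x * g x

/-- The distributional fractional divergence is unique on an open set. -/
theorem IsFracDivOn.unique {d : ℕ} {s : ℝ} {Ω : Set (E d)} (hΩ : IsOpen Ω) {Ψ : L2Vec d}
    {g h : L2On Ω} (hg : IsFracDivOn s Ω Ψ g) (hh : IsFracDivOn s Ω Ψ h) : g = h := by
  have key : ∀ u : L2On Ω, LocallyIntegrableOn u Ω volume := by
    intro u
    rw [locallyIntegrableOn_iff hΩ.isLocallyClosed]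
    intro k hk hkc
    have h1 : MemLp u 2 (volume.restrict k) :=
      (Lp.memLp u).mono_measure (Measure.restrict_mono hk le_rfl)
    have : IsFiniteMeasure (volume.restrict k : Measure (E d)) :=
      ⟨by simpa using hkc.measure_lt_top⟩
    exact h1.integrable (by norm_num)
  have hint : ∀ u : L2On Ω, ∀ φ, IsTestFunction Ω φ →
      Integrable (fun x => φ x * u x) (volume.restrict Ω) := by
    intro u φ hφ
    have h1 : MemLp φ 2 (volume.restrict Ω) :=
      (hφ.1.continuous.memLp_of_hasCompactSupport hφ.2.1).restrict Ω
    exact h1.integrable_mul (Lp.memLp u)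
  have hae := hΩ.ae_eq_zero_of_integral_contDiff_smul_eq_zero (μ := (volume : Measure (E d)))
    (f := fun x => g x - h x) ((key g).sub (key h)) (by
      intro φ h1 h2 h3
      have hφ : IsTestFunction Ω φ := ⟨h1, h2, h3⟩
      have h4 : ∫ x in Ω, φ x * (g x - h x) = 0 := by
        simp_rw [mul_sub]
        rw [integral_sub (hint g φ hφ) (hint h φ hφ)]
        linarith [hg φ hφ, hh φ hφ]
      rw [← h4, setIntegral_eq_integral_of_forall_compl_eq_zero]
      · simp
      · intro x hx
        have : φ x = 0 := image_eq_zero_of_notMem_tsupport fun hx' => hx (h3 hx')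
        simp [this])
  apply Lp.ext
  rw [Filter.EventuallyEq, ae_restrict_iff' hΩ.measurableSet]
  filter_upwards [hae] with x hx hxΩ
  exact sub_eq_zero.1 (hx hxΩ)

/-- The space `H(div^s; Ω)`: square-integrable vector fields on `ℝ^d` whose fractional divergence,
restricted to `Ω`, is square-integrable on `Ω`. -/
def HDiv {d : ℕ} (s : ℝ) (Ω : Set (E d)) : Set (L2Vec d) :=
  {Ψ | ∃ g : L2On Ω, IsFracDivOn s Ω Ψ g}

open Classical in
/-- The restriction to `Ω` of the fractional divergence of a field in `H(div^s; Ω)` (and `0` for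
other fields). -/
noncomputable def fracDivOn {d : ℕ} (s : ℝ) (Ω : Set (E d)) (Ψ : L2Vec d) : L2On Ω :=
  if h : ∃ g : L2On Ω, IsFracDivOn s Ω Ψ g then h.choose else 0

theorem isFracDivOn_fracDivOn {d : ℕ} {s : ℝ} {Ω : Set (E d)} {Ψ : L2Vec d}
    (hΨ : Ψ ∈ HDiv s Ω) : IsFracDivOn s Ω Ψ (fracDivOn s Ω Ψ) := by
  have h : ∃ g : L2On Ω, IsFracDivOn s Ω Ψ g := hΨ
  rw [fracDivOn, dif_pos h]
  exact h.choose_spec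

/-- The norm of `H(div^s; Ω)`. -/
noncomputable def hdivNorm {d : ℕ} (s : ℝ) (Ω : Set (E d)) (Ψ : L2Vec d) : ℝ :=
  Real.sqrt (‖Ψ‖ ^ 2 + ‖fracDivOn s Ω Ψ‖ ^ 2)

/-- Square-integrable functions on `Ω`, extended by zero to the complement of `Ω`. -/
def TildeL2 {d : ℕ} (Ω : Set (E d)) : Set (L2 d) :=
  {q | ∀ᵐ x, x ∉ Ω → q x = 0}

/-- The square of the Gagliardo seminorm of `H^s(ℝ^d)`, as an extended nonnegative number. -/
noncomputable def gagliardoSq {d : ℕ} (s : ℝ) (w : E d → ℝ) : ℝ≥0∞ :=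
  ENNReal.ofReal (nu d s / 2) *
    ∫⁻ y, ∫⁻ x, ENNReal.ofReal (|w x - w y| ^ 2 / ‖x - y‖ ^ ((d : ℝ) + 2 * s))

/-- The Gagliardo seminorm of a function in `H^s(ℝ^d)`. -/
noncomputable def hsSeminorm {d : ℕ} (s : ℝ) (w : E d → ℝ) : ℝ :=
  Real.sqrt (gagliardoSq s w).toReal

/-- Functions in `H^s(ℝ^d)` with support in the closure of `Ω`. -/
def TildeHs {d : ℕ} (s : ℝ) (Ω : Set (E d)) : Set (L2 d) :=
  {w | gagliardoSq s w < ⊤ ∧ ∀ᵐ x, x ∉ closure Ω → w x = 0}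

/-- `C` is a constant in the fractional Poincaré inequality on `Ω`. -/
def IsPoincareConstant {d : ℕ} (s : ℝ) (Ω : Set (E d)) (C : ℝ) : Prop :=
  0 ≤ C ∧ ∀ w ∈ TildeHs s Ω,
    (eLpNorm w 2 (volume.restrict Ω)).toReal ≤ C * hsSeminorm s w

/-- `(p, Φ)` solves the weak mixed (Darcy) problem with right-hand side `f`. -/
def IsWeakSolution {d : ℕ} (s : ℝ) (Ω : Set (E d)) (f : L2On Ω) (p : L2 d) (Φ : L2Vec d) : Prop :=
  p ∈ TildeL2 Ω ∧ Φ ∈ HDiv s Ω ∧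
    ∀ q ∈ TildeL2 Ω, ∀ Ψ ∈ HDiv s Ω,
      (∫ x, inner ℝ (Φ x) (Ψ x)) - (∫ x in Ω, p x * fracDivOn s Ω Ψ x)
        + (∫ x in Ω, q x * fracDivOn s Ω Φ x) = ∫ x in Ω, f x * q x

end FracDarcy

/-! The mixed problem says that div^s Φ = f on Ω and that Φ = -grad^s p weakly, with p vanishing
outside Ω. Close the graph of grad^s on test functions in L²(Ω) × L²(ℝ^d)^d. If ‖φ‖ ≤ C ‖grad^s φ‖
for test functions, this persists on the closure, so the inner product of second components is
coercive there. Lax–Milgram yields (p, G) in the closure with ⟪G, w₂⟫ = ⟪f, w₁⟫ for all (w₁, w₂) in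
it. Put Φ = -G: this equation is div^s Φ = f, and integration by parts, also stable under closure,
gives ⟪Φ, Ψ⟫ = ∫ p div^s Ψ. Testing with the solution gives ‖Φ‖ ≤ C ‖f‖ and ‖p‖ ≤ C² ‖f‖. Uniqueness
of p uses that div^s is onto L²(Ω), which the existence result contains.

The estimates must hold with the constant of the Gagliardo seminorm, so the core is
`gagliardoSq_le_lintegral_fracGrad`: the seminorm of a test function is at most the norm of its
fractional gradient, with constant 1. By Plancherel this compares Fourier symbols. The
Lévy–Khintchine formula `lintegral_one_sub_cos_div_rpow` at exponent s identifies the seminorm with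
the weight (2π|ξ|)^(2s). The same formula at exponent (1+s)/2, differentiated under scaling of ξ,
evaluates the symbol of grad^s in the direction ξ, and Cauchy–Schwarz bounds the whole symbol from
below. Equality of the symbols is not needed. -/

namespace FracDarcy

open scoped FourierTransform SchwartzMap RealInnerProductSpace

/-! ### Plancherel's theorem for Fourier integrals on L¹ ∩ L² -/

section Plancherel

variable {V : Type*} [NormedAddCommGroup V] [InnerProductSpace ℝ V] [FiniteDimensional ℝ V]
  [MeasurableSpace V] [BorelSpace V]

/-- The Fourier transform on `L²` is given by the Fourier integral on `L¹ ∩ L²`. -/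
theorem coeFn_fourier_toLp_ae_eq {u : V → ℂ} (hu : Integrable u) (hu2 : MemLp u 2) :
    (𝓕 (hu2.toLp u) : Lp ℂ 2 (volume : Measure V)) =ᵐ[volume] 𝓕 u := by
  have hc : Continuous (𝓕 u) := by
    exact VectorFourier.fourierIntegral_continuous Real.continuous_fourierChar
      continuous_inner hu
  refine ae_eq_of_integral_contDiff_smul_eq ?_ hc.locallyIntegrable ?_
  · exact (Lp.memLp _).locallyIntegrable (by norm_num)
  intro g hg hgc
  have hgc' : HasCompactSupport fun x => (g x : ℂ) := hgc.comp_left (g := fun r : ℝ => (r : ℂ)) (by simp)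
  have hg' : ContDiff ℝ ∞ fun x => (g x : ℂ) := Complex.ofRealCLM.contDiff.comp hg
  set G : 𝓢(V, ℂ) := hgc'.toSchwartzMap hg' with hG
  have hGg : ∀ x, G x = g x := fun x => rfl
  -- The L² transform agrees with the distributional one, so it can be moved onto the test function
  -- `G`; the L¹ multiplication formula then moves it back onto `u`.
  have key := congrArg (fun T : 𝓢'(V, ℂ) => T G) (Lp.fourier_toTemperedDistribution_eq (hu2.toLp u))
  simp only [TemperedDistribution.fourier_apply, Lp.toTemperedDistribution_apply] at key
  calc ∫ x, g x • (𝓕 (hu2.toLp u) : Lp ℂ 2 (volume : Measure V)) x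
      = ∫ x, G x • (𝓕 (hu2.toLp u) : Lp ℂ 2 (volume : Measure V)) x := by simp [hGg]
    _ = ∫ x, (𝓕 G) x • (hu2.toLp u) x := key.symm
    _ = ∫ x, (𝓕 (G : V → ℂ)) x • u x := by
        apply integral_congr_ae
        filter_upwards [hu2.coeFn_toLp] with x hx
        rw [hx, SchwartzMap.fourier_coe]
    _ = ∫ x, G x • (𝓕 u) x := by
        have h := VectorFourier.integral_fourierIntegral_smul_eq_flip (μ := (volume : Measure V))
          (ν := (volume : Measure V)) (L := innerₗ V)
          Real.continuous_fourierChar continuous_inner (G.integrable (μ := volume)) hu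
        rw [flip_innerₗ] at h
        exact h
    _ = ∫ x, g x • (𝓕 u) x := by simp [hGg]
  rfl

theorem lintegral_enorm_sq_eq_eLpNorm_sq {α F : Type*} [MeasurableSpace α] [NormedAddCommGroup F]
    (μ : Measure α) (v : α → F) : ∫⁻ x, ‖v x‖ₑ ^ 2 ∂μ = eLpNorm v 2 μ ^ 2 := by
  rw [eLpNorm_eq_lintegral_rpow_enorm_toReal two_ne_zero ENNReal.ofNat_ne_top,
    ← ENNReal.rpow_natCast, ← ENNReal.rpow_mul]
  simp

/-- **Plancherel's theorem** on `L¹ ∩ L²`. -/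
theorem lintegral_enorm_sq_fourier {u : V → ℂ} (hu : Integrable u) (hu2 : MemLp u 2) :
    ∫⁻ ξ, ‖𝓕 u ξ‖ₑ ^ 2 = ∫⁻ x, ‖u x‖ₑ ^ 2 := by
  have h := Lp.norm_fourier_eq (hu2.toLp u)
  rw [Lp.norm_def, Lp.norm_def, ENNReal.toReal_eq_toReal_iff' (Lp.memLp _).2.ne (Lp.memLp _).2.ne,
    eLpNorm_congr_ae (coeFn_fourier_toLp_ae_eq hu hu2), eLpNorm_congr_ae hu2.coeFn_toLp] at h
  rw [lintegral_enorm_sq_eq_eLpNorm_sq, lintegral_enorm_sq_eq_eLpNorm_sq, h]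

/-- The Fourier transform of a translate. -/
theorem fourier_comp_add_right (u : V → ℂ) (h ξ : V) :
    𝓕 (fun x => u (x + h)) ξ = Complex.exp ((2 * Real.pi * ⟪h, ξ⟫ : ℝ) * Complex.I) * 𝓕 u ξ := by
  have := congrFun (VectorFourier.fourierIntegral_comp_add_right Real.fourierChar
    (volume : Measure V) (innerₗ V) u h) ξ
  refine this.trans ?_
  rw [Circle.smul_def, Real.fourierChar_apply]
  rfl

end Plancherel

/-! ### The Lévy–Khintchine formula by Gaussian subordination -/

section Subordination

open Real Set

theorem lintegral_rpow_mul_exp_neg_mul_Ioi {a r : ℝ} (ha : 0 < a) (hr : 0 < r) :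
    ∫⁻ t in Ioi (0 : ℝ), ENNReal.ofReal (t ^ (a - 1) * exp (-(r * t)))
      = ENNReal.ofReal (Gamma a * r ^ (-a)) := by
  have h := integral_rpow_mul_exp_neg_mul_Ioi ha hr
  have hG := Gamma_pos_of_pos ha
  rw [← ofReal_integral_eq_lintegral_ofReal, h, one_div, inv_rpow hr.le, ← rpow_neg hr.le, mul_comm]
  -- A nonintegrable function has integral `0` by convention, so the nonzero closed form already
  -- proves integrability.
  · refine Integrable.of_integral_ne_zero ?_
    rw [h]; positivity
  · filter_upwards [ae_restrict_mem measurableSet_Ioi] with t ht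
    have : (0 : ℝ) < t := ht
    positivity

/-- The substitution t ↦ 1/t turns this into a Gamma integral with parameter 1 - σ. -/
theorem lintegral_rpow_mul_exp_neg_div_Ioi {σ v : ℝ} (hσ : σ < 1) (hv : 0 < v) :
    ∫⁻ t in Ioi (0 : ℝ), ENNReal.ofReal (t ^ (σ - 2) * exp (-(v / t)))
      = ENNReal.ofReal (Gamma (1 - σ) * v ^ (σ - 1)) := by
  have hσ' : 0 < 1 - σ := by linarith
  have h := integral_rpow_mul_exp_neg_mul_Ioi hσ' hv
  have hG := Gamma_pos_of_pos hσ'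
  rw [← integral_comp_rpow_Ioi _ (show (-1 : ℝ) ≠ 0 by norm_num)] at h
  have e : ∫ t in Ioi (0 : ℝ), t ^ (σ - 2) * exp (-(v / t)) = (1 / v) ^ (1 - σ) * Gamma (1 - σ) := by
    rw [← h]
    refine setIntegral_congr_fun measurableSet_Ioi fun t ht => ?_
    have ht' : (0 : ℝ) < t := ht
    simp only [smul_eq_mul]
    rw [← rpow_mul ht'.le, abs_neg, abs_one, one_mul, ← mul_assoc, ← rpow_add ht', rpow_neg_one,
      div_eq_mul_inv]
    congr 2
    ring
  rw [← ofReal_integral_eq_lintegral_ofReal, e, one_div, inv_rpow hv.le, ← rpow_neg hv.le, mul_comm]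
  · congr 3; ring
  · refine Integrable.of_integral_ne_zero ?_
    rw [e]; positivity
  · filter_upwards [ae_restrict_mem measurableSet_Ioi] with t ht
    have : (0 : ℝ) < t := ht
    positivity

theorem lintegral_rpow_Ioc {σ c : ℝ} (hσ : 0 < σ) (hc : 0 ≤ c) :
    ∫⁻ v in Ioc 0 c, ENNReal.ofReal (v ^ (σ - 1)) = ENNReal.ofReal (c ^ σ / σ) := by
  have h := integral_rpow (a := 0) (b := c) (r := σ - 1) (Or.inl (by linarith))
  have hi := intervalIntegral.intervalIntegrable_rpow' (a := 0) (b := c) (r := σ - 1) (by linarith)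
  rw [intervalIntegrable_iff_integrableOn_Ioc_of_le hc] at hi
  rw [intervalIntegral.integral_of_le hc, sub_add_cancel, zero_rpow hσ.ne', sub_zero] at h
  rw [← ofReal_integral_eq_lintegral_ofReal hi, h]
  filter_upwards [ae_restrict_mem measurableSet_Ioc] with t ht
  exact rpow_nonneg ht.1.le _

theorem lintegral_exp_neg_div_Ioc {t c : ℝ} (ht : 0 < t) (hc : 0 ≤ c) :
    ∫⁻ v in Ioc 0 c, ENNReal.ofReal (exp (-(v / t))) = ENNReal.ofReal (t * (1 - exp (-(c / t)))) := by
  have h : ∫ v in (0 : ℝ)..c, exp (-(v / t)) = t * (1 - exp (-(c / t))) := by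
    have h1 : ∀ v ∈ uIcc 0 c, HasDerivAt (fun v => -(t * exp (-(v / t)))) (exp (-(v / t))) v := by
      intro v _
      have := ((((hasDerivAt_id v).div_const t).fun_neg).exp.const_mul t).fun_neg
      refine this.congr_deriv ?_
      simp only [id]
      field_simp
    rw [intervalIntegral.integral_eq_sub_of_hasDerivAt h1
      ((by fun_prop : Continuous fun v : ℝ => exp (-(v / t))).intervalIntegrable _ _)]
    simp; ring
  rw [intervalIntegral.integral_of_le hc] at h
  rw [← ofReal_integral_eq_lintegral_ofReal _ (Filter.Eventually.of_forall fun v => (exp_pos _).le), h]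
  exact ((by fun_prop : Continuous fun v : ℝ => exp (-(v / t))).integrableOn_Ioc)

/-- Since t (1 - exp(-c/t)) is the integral of exp(-v/t) over 0 < v ≤ c, Tonelli allows integrating
in t first; what remains is v^(σ-1) on (0, c]. -/
theorem lintegral_rpow_mul_one_sub_exp {σ c : ℝ} (hσ0 : 0 < σ) (hσ : σ < 1) (hc : 0 ≤ c) :
    ∫⁻ t in Ioi (0 : ℝ), ENNReal.ofReal (t ^ (σ - 1) * (1 - exp (-(c / t))))
      = ENNReal.ofReal (Gamma (1 - σ) * c ^ σ / σ) := by
  calc ∫⁻ t in Ioi (0 : ℝ), ENNReal.ofReal (t ^ (σ - 1) * (1 - exp (-(c / t))))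
      = ∫⁻ t in Ioi (0 : ℝ), ∫⁻ v in Ioc 0 c, ENNReal.ofReal (t ^ (σ - 2) * exp (-(v / t))) := by
        refine setLIntegral_congr_fun measurableSet_Ioi fun t ht => ?_
        have ht' : (0 : ℝ) < t := ht
        have hp : (0 : ℝ) ≤ t ^ (σ - 2) := by positivity
        simp_rw [ENNReal.ofReal_mul hp]
        rw [lintegral_const_mul' _ _ ENNReal.ofReal_ne_top, lintegral_exp_neg_div_Ioc ht' hc,
          ← ENNReal.ofReal_mul hp, ← mul_assoc, ← rpow_add_one ht'.ne']
        congr 3; ring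
    _ = ∫⁻ v in Ioc 0 c, ∫⁻ t in Ioi (0 : ℝ), ENNReal.ofReal (t ^ (σ - 2) * exp (-(v / t))) := by
        refine lintegral_lintegral_swap (Measurable.aemeasurable ?_)
        fun_prop
    _ = ∫⁻ v in Ioc 0 c, ENNReal.ofReal (Gamma (1 - σ)) * ENNReal.ofReal (v ^ (σ - 1)) := by
        refine setLIntegral_congr_fun measurableSet_Ioc fun v hv => ?_
        rw [lintegral_rpow_mul_exp_neg_div_Ioi hσ hv.1, ENNReal.ofReal_mul]
        exact (Gamma_pos_of_pos (by linarith)).le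
    _ = _ := by
        rw [lintegral_const_mul' _ _ ENNReal.ofReal_ne_top, lintegral_rpow_Ioc hσ0 hc,
          ← ENNReal.ofReal_mul (Gamma_pos_of_pos (by linarith)).le, mul_div_assoc]

variable {d : ℕ}

theorem integrable_exp_neg_mul_sq_norm {t : ℝ} (ht : 0 < t) :
    Integrable fun h : E d => exp (-(t * ‖h‖ ^ 2)) := by
  refine Integrable.of_integral_ne_zero ?_
  have := GaussianFourier.integral_rexp_neg_mul_sq_norm (V := E d) ht
  simp only [neg_mul] at this
  rw [this]
  positivity

/-- This is the real part of the complex Gaussian integral with linear term 2πi⟪ξ, h⟫. -/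
theorem integral_cos_mul_exp_neg_mul_sq_norm {t : ℝ} (ht : 0 < t) (ξ : E d) :
    ∫ h : E d, cos (2 * π * ⟪h, ξ⟫) * exp (-(t * ‖h‖ ^ 2))
      = (π / t) ^ ((d : ℝ) / 2) * exp (-(π ^ 2 * ‖ξ‖ ^ 2 / t)) := by
  have h := GaussianFourier.integral_cexp_neg_mul_sq_norm_add (V := E d) (b := t) (by simpa using ht)
    (2 * π * Complex.I) ξ
  have h2 := congrArg Complex.re h
  rw [← RCLike.re_eq_complex_re, ← integral_re] at h2
  · convert h2 using 1
    · refine integral_congr_ae (Filter.Eventually.of_forall fun x => ?_)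
      simp only [RCLike.re_eq_complex_re]
      rw [show (-(t : ℂ) * ‖x‖ ^ 2 + 2 * π * Complex.I * (⟪ξ, x⟫ : ℝ)) =
        ((-(t * ‖x‖ ^ 2) : ℝ) : ℂ) + ((2 * π * ⟪x, ξ⟫ : ℝ) : ℂ) * Complex.I by
          rw [real_inner_comm]; push_cast; ring, Complex.exp_add, ← Complex.ofReal_exp,
          Complex.re_ofReal_mul, Complex.exp_ofReal_mul_I_re, mul_comm]
    · rw [show ((2 * π * Complex.I) ^ 2 * ‖ξ‖ ^ 2 / (4 * t) : ℂ) = ((-(π ^ 2 * ‖ξ‖ ^ 2 / t) : ℝ) : ℂ) by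
        rw [mul_pow, Complex.I_sq]; push_cast; field_simp; ring]
      rw [← Complex.ofReal_exp, RCLike.re_eq_complex_re, Complex.re_mul_ofReal]
      congr 1
      simp only [finrank_euclideanSpace, Fintype.card_fin]
      rw [← Complex.ofReal_div, show ((d : ℂ) / 2) = (((d : ℝ) / 2 : ℝ) : ℂ) by push_cast; rfl,
        ← Complex.ofReal_cpow (by positivity), Complex.ofReal_re]
  · refine Integrable.of_integral_ne_zero ?_
    rw [h]
    refine mul_ne_zero ?_ (Complex.exp_ne_zero _)
    rw [← Complex.ofReal_div, Complex.cpow_def_of_ne_zero]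
    · exact Complex.exp_ne_zero _
    · exact_mod_cast (by positivity : π / t ≠ 0)

theorem lintegral_one_sub_cos_mul_exp {t : ℝ} (ht : 0 < t) (ξ : E d) :
    ∫⁻ h : E d, ENNReal.ofReal ((1 - cos (2 * π * ⟪h, ξ⟫)) * exp (-(t * ‖h‖ ^ 2)))
      = ENNReal.ofReal ((π / t) ^ ((d : ℝ) / 2) * (1 - exp (-(π ^ 2 * ‖ξ‖ ^ 2 / t)))) := by
  have h0 := GaussianFourier.integral_rexp_neg_mul_sq_norm (V := E d) ht
  simp only [neg_mul, finrank_euclideanSpace, Fintype.card_fin] at h0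
  have hi : Integrable fun h : E d => cos (2 * π * ⟪h, ξ⟫) * exp (-(t * ‖h‖ ^ 2)) :=
    (integrable_exp_neg_mul_sq_norm ht).bdd_mul (c := 1) (by fun_prop)
      (Filter.Eventually.of_forall fun x => by simpa using abs_cos_le_one _)
  have hs : Integrable fun h : E d =>
      exp (-(t * ‖h‖ ^ 2)) - cos (2 * π * ⟪h, ξ⟫) * exp (-(t * ‖h‖ ^ 2)) :=
    (integrable_exp_neg_mul_sq_norm ht).sub hi
  simp_rw [sub_mul, one_mul]
  rw [← ofReal_integral_eq_lintegral_ofReal hs,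
    integral_sub (integrable_exp_neg_mul_sq_norm ht) hi, h0, integral_cos_mul_exp_neg_mul_sq_norm ht]
  · congr 1; ring
  · refine Filter.Eventually.of_forall fun x => ?_
    simp only [Pi.zero_apply, sub_nonneg]
    exact mul_le_of_le_one_left (exp_pos _).le (cos_le_one _)

/-- The constant in the Lévy–Khintchine representation of `|ξ| ^ (2 * σ)`. -/
noncomputable def levyConst (d : ℕ) (σ : ℝ) : ℝ :=
  π ^ ((d : ℝ) / 2) * π ^ (2 * σ) * Gamma (1 - σ) / (σ * Gamma (d / 2 + σ))

theorem levyConst_pos {σ : ℝ} (h0 : 0 < σ) (h1 : σ < 1) : 0 < levyConst d σ := by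
  have := Gamma_pos_of_pos (show 0 < 1 - σ by linarith)
  have := Gamma_pos_of_pos (show 0 < (d : ℝ) / 2 + σ by positivity)
  unfold levyConst
  positivity

/-- The Lévy–Khintchine representation of `|ξ| ^ (2 * σ)`. -/
theorem lintegral_one_sub_cos_div_rpow {σ : ℝ} (h0 : 0 < σ) (h1 : σ < 1) (ξ : E d) :
    ∫⁻ h : E d, ENNReal.ofReal ((1 - cos (2 * π * ⟪h, ξ⟫)) / ‖h‖ ^ ((d : ℝ) + 2 * σ))
      = ENNReal.ofReal (levyConst d σ * ‖ξ‖ ^ (2 * σ)) := by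
  -- The power ‖h‖^(-2a) is a Gamma-weighted average of the Gaussians exp(-t‖h‖²). After Tonelli the
  -- h-integral is Gaussian and contributes t^(-d/2), leaving the weight t^(a-1-d/2) = t^(σ-1).
  set a : ℝ := d / 2 + σ with ha
  have ha0 : 0 < a := by positivity
  have hG := Gamma_pos_of_pos ha0
  have hG1 := Gamma_pos_of_pos (show 0 < 1 - σ by linarith)
  calc ∫⁻ h : E d, ENNReal.ofReal ((1 - cos (2 * π * ⟪h, ξ⟫)) / ‖h‖ ^ ((d : ℝ) + 2 * σ))
      = ∫⁻ h : E d, ∫⁻ t in Ioi (0 : ℝ), ENNReal.ofReal ((Gamma a)⁻¹ * t ^ (a - 1)) *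
          ENNReal.ofReal ((1 - cos (2 * π * ⟪h, ξ⟫)) * exp (-(t * ‖h‖ ^ 2))) := by
        refine lintegral_congr fun h => ?_
        rcases eq_or_ne h 0 with rfl | hh
        · simp
        have hh' : 0 < ‖h‖ := norm_pos_iff.2 hh
        have hcos : 0 ≤ 1 - cos (2 * π * ⟪h, ξ⟫) := sub_nonneg.2 (cos_le_one _)
        have e : ∀ t ∈ Ioi (0 : ℝ), ENNReal.ofReal ((Gamma a)⁻¹ * t ^ (a - 1)) *
            ENNReal.ofReal ((1 - cos (2 * π * ⟪h, ξ⟫)) * exp (-(t * ‖h‖ ^ 2))) =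
            ENNReal.ofReal ((Gamma a)⁻¹ * (1 - cos (2 * π * ⟪h, ξ⟫))) *
              ENNReal.ofReal (t ^ (a - 1) * exp (-(‖h‖ ^ 2 * t))) := by
          intro t ht
          have ht' : (0 : ℝ) < t := ht
          rw [← ENNReal.ofReal_mul (by positivity), ← ENNReal.ofReal_mul (by positivity)]
          congr 1
          rw [mul_comm t]; ring
        rw [setLIntegral_congr_fun measurableSet_Ioi e, lintegral_const_mul' _ _ ENNReal.ofReal_ne_top,
          lintegral_rpow_mul_exp_neg_mul_Ioi ha0 (by positivity), ← ENNReal.ofReal_mul (by positivity)]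
        congr 1
        rw [← rpow_natCast, ← rpow_mul hh'.le, show ((2 : ℕ) : ℝ) * -a = -((d : ℝ) + 2 * σ) by
          rw [ha]; push_cast; ring, rpow_neg hh'.le]
        field_simp
    _ = ∫⁻ t in Ioi (0 : ℝ), ∫⁻ h : E d, ENNReal.ofReal ((Gamma a)⁻¹ * t ^ (a - 1)) *
          ENNReal.ofReal ((1 - cos (2 * π * ⟪h, ξ⟫)) * exp (-(t * ‖h‖ ^ 2))) := by
        refine lintegral_lintegral_swap (Measurable.aemeasurable ?_)
        fun_prop
    _ = ∫⁻ t in Ioi (0 : ℝ), ENNReal.ofReal ((Gamma a)⁻¹ * π ^ ((d : ℝ) / 2)) *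
          ENNReal.ofReal (t ^ (σ - 1) * (1 - exp (-((π ^ 2 * ‖ξ‖ ^ 2) / t)))) := by
        refine setLIntegral_congr_fun measurableSet_Ioi fun t ht => ?_
        have ht' : (0 : ℝ) < t := ht
        rw [lintegral_const_mul' _ _ ENNReal.ofReal_ne_top, lintegral_one_sub_cos_mul_exp ht',
          ← ENNReal.ofReal_mul (by positivity), ← ENNReal.ofReal_mul (by positivity)]
        congr 1
        rw [show a - 1 = (σ - 1) + d / 2 by rw [ha]; ring, rpow_add ht', div_rpow pi_pos.le ht'.le]
        field_simp
    _ = _ := by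
        rw [lintegral_const_mul' _ _ ENNReal.ofReal_ne_top,
          lintegral_rpow_mul_one_sub_exp h0 h1 (by positivity), ← ENNReal.ofReal_mul (by positivity)]
        congr 1
        rw [mul_rpow (by positivity) (by positivity), ← rpow_natCast, ← rpow_natCast,
          ← rpow_mul pi_pos.le, ← rpow_mul (norm_nonneg _), levyConst, ← ha]
        push_cast
        field_simp

end Subordination

/-! ### The sine integral behind the symbol of the fractional gradient -/

section SineKernel

open Real Set

variable {d : ℕ}

/-- In polar coordinates the radial density is r^(-s) up to 1 and r^(-1-s) beyond, both integrable
for 0 < s < 1. This function dominates the integrands of the fractional gradient and of its symbol.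
-/
theorem integrable_min_one_norm_div_rpow (hd : 1 ≤ d) {s : ℝ} (hs0 : 0 < s) (hs1 : s < 1) :
    Integrable fun h : E d => min 1 ‖h‖ / ‖h‖ ^ ((d : ℝ) + s) := by
  have : NeZero d := ⟨by omega⟩
  refine (integrable_fun_norm_addHaar (volume : Measure (E d))
    (f := fun r : ℝ => min 1 r / r ^ ((d : ℝ) + s))).2 ?_
  have hpow : ∀ y : ℝ, 0 < y → y ^ (d - 1) = y ^ ((d : ℝ) - 1) := fun y hy => by
    rw [← rpow_natCast, Nat.cast_sub hd, Nat.cast_one]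
  rw [finrank_euclideanSpace, Fintype.card_fin, ← Ioc_union_Ioi_eq_Ioi (zero_le_one (α := ℝ))]
  refine IntegrableOn.union ?_ ?_
  · have h := intervalIntegral.intervalIntegrable_rpow' (a := 0) (b := 1) (r := -s) (by linarith)
    rw [intervalIntegrable_iff_integrableOn_Ioc_of_le zero_le_one] at h
    refine h.congr_fun (fun y hy => ?_) measurableSet_Ioc
    simp only [smul_eq_mul]
    rw [min_eq_right hy.2, hpow y hy.1, mul_div_assoc', ← rpow_add_one hy.1.ne', ← rpow_sub hy.1]
    congr 1; ring
  · refine (integrableOn_Ioi_rpow_of_lt (a := -1 - s) (by linarith) one_pos).congr_fun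
      (fun y hy => ?_) measurableSet_Ioi
    have hy1 : 1 < y := hy
    have hy0 : 0 < y := one_pos.trans hy1
    simp only [smul_eq_mul]
    rw [min_eq_left hy1.le, hpow y hy0, mul_one_div, ← rpow_sub hy0]
    congr 1; ring

theorem integrable_one_sub_cos_div_rpow {σ : ℝ} (h0 : 0 < σ) (h1 : σ < 1) (ξ : E d) :
    Integrable fun h : E d => (1 - cos (2 * π * ⟪h, ξ⟫)) / ‖h‖ ^ ((d : ℝ) + 2 * σ) := by
  have hm : Measurable fun h : E d => (1 - cos (2 * π * ⟪h, ξ⟫)) / ‖h‖ ^ ((d : ℝ) + 2 * σ) := by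
    fun_prop
  refine (lintegral_ofReal_ne_top_iff_integrable hm.aestronglyMeasurable
    (Filter.Eventually.of_forall fun h => ?_)).1 ?_
  · have := cos_le_one (2 * π * ⟪h, ξ⟫)
    simp only [Pi.zero_apply]
    exact div_nonneg (by linarith) (by positivity)
  · rw [lintegral_one_sub_cos_div_rpow h0 h1]
    exact ENNReal.ofReal_ne_top

theorem integral_one_sub_cos_div_rpow {σ : ℝ} (h0 : 0 < σ) (h1 : σ < 1) (ξ : E d) :
    ∫ h : E d, (1 - cos (2 * π * ⟪h, ξ⟫)) / ‖h‖ ^ ((d : ℝ) + 2 * σ)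
      = levyConst d σ * ‖ξ‖ ^ (2 * σ) := by
  have hL := levyConst_pos (d := d) h0 h1
  rw [integral_eq_lintegral_of_nonneg_ae _
    (integrable_one_sub_cos_div_rpow h0 h1 ξ).aestronglyMeasurable,
    lintegral_one_sub_cos_div_rpow h0 h1, ENNReal.toReal_ofReal (by positivity)]
  refine Filter.Eventually.of_forall fun h => ?_
  have := cos_le_one (2 * π * ⟪h, ξ⟫)
  simp only [Pi.zero_apply]
  exact div_nonneg (by linarith) (by positivity)

theorem abs_sin_le_min {a b : ℝ} (hb : |a| ≤ b) : |sin a| ≤ min 1 b :=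
  le_min (abs_sin_le_one a) ((abs_sin_le_abs).trans hb)

/-- Dominated differentiation: for |l - 1| < 1 the sine is at most a multiple of min(1, ‖h‖), and
the factor ⟪h, ξ⟫ cancels one power of ‖h‖ in the denominator ‖h‖^(d+s+1). -/
theorem hasDerivAt_integral_one_sub_cos (hd : 1 ≤ d) {s : ℝ} (hs0 : 0 < s) (hs1 : s < 1) (ξ : E d) :
    HasDerivAt
      (fun l : ℝ => ∫ h : E d, (1 - cos (2 * π * (l * ⟪h, ξ⟫))) / ‖h‖ ^ ((d : ℝ) + 2 * ((1 + s) / 2)))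
      (∫ h : E d, 2 * π * (sin (2 * π * (1 * ⟪h, ξ⟫)) * ⟪h, ξ⟫) /
        ‖h‖ ^ ((d : ℝ) + 2 * ((1 + s) / 2))) 1 := by
  set M : ℝ := max 1 (4 * π * ‖ξ‖) with hM
  refine (hasDerivAt_integral_of_dominated_loc_of_deriv_le
    (F := fun (l : ℝ) (h : E d) =>
      (1 - cos (2 * π * (l * ⟪h, ξ⟫))) / ‖h‖ ^ ((d : ℝ) + 2 * ((1 + s) / 2)))
    (F' := fun (l : ℝ) (h : E d) => 2 * π * (sin (2 * π * (l * ⟪h, ξ⟫)) * ⟪h, ξ⟫) /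
        ‖h‖ ^ ((d : ℝ) + 2 * ((1 + s) / 2)))
    (bound := fun h => (2 * π * ‖ξ‖ * M) * (min 1 ‖h‖ / ‖h‖ ^ ((d : ℝ) + s)))
    (Metric.ball_mem_nhds (1 : ℝ) one_pos) ?_ ?_ ?_ ?_ ?_ ?_).2
  · refine Filter.Eventually.of_forall fun l => Measurable.aestronglyMeasurable ?_
    fun_prop
  · simpa using integrable_one_sub_cos_div_rpow (d := d) (σ := (1 + s) / 2) (by linarith)
      (by linarith) ξ
  · refine Measurable.aestronglyMeasurable ?_
    fun_prop
  · refine Filter.Eventually.of_forall fun h l hl => ?_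
    rcases eq_or_ne h 0 with rfl | hh
    · simp
    have hh' : 0 < ‖h‖ := norm_pos_iff.2 hh
    have hl2 : |l| ≤ 2 := by
      rw [Metric.mem_ball, Real.dist_eq, abs_lt] at hl
      rw [abs_le]; constructor <;> linarith
    have hin : |⟪h, ξ⟫| ≤ ‖h‖ * ‖ξ‖ := abs_real_inner_le_norm h ξ
    have hsin : |sin (2 * π * (l * ⟪h, ξ⟫))| ≤ M * min 1 ‖h‖ := by
      have h1 : |2 * π * (l * ⟪h, ξ⟫)| ≤ (4 * π * ‖ξ‖) * ‖h‖ := by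
        rw [abs_mul, abs_mul, abs_mul, abs_of_pos pi_pos, abs_two]
        calc 2 * π * (|l| * |⟪h, ξ⟫|) ≤ 2 * π * (2 * (‖h‖ * ‖ξ‖)) := by gcongr
          _ = _ := by ring
      refine (abs_sin_le_min h1).trans ?_
      have hM1 : 1 ≤ M := le_max_left _ _
      have hM2 : 4 * π * ‖ξ‖ ≤ M := le_max_right _ _
      rw [mul_min_of_nonneg _ _ (by positivity), mul_one]
      exact min_le_min hM1 (by gcongr)
    rw [norm_eq_abs, abs_div, abs_mul, abs_mul, abs_mul, abs_of_pos pi_pos, abs_two,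
      abs_of_nonneg (rpow_nonneg (norm_nonneg h) _),
      show (d : ℝ) + 2 * ((1 + s) / 2) = (d + s) + 1 by ring, rpow_add_one hh'.ne', mul_div_assoc',
      div_le_div_iff₀ (by positivity) (by positivity)]
    have hM0 : 0 ≤ M * min 1 ‖h‖ := (abs_nonneg _).trans hsin
    calc 2 * π * (|sin (2 * π * (l * ⟪h, ξ⟫))| * |⟪h, ξ⟫|) * ‖h‖ ^ ((d : ℝ) + s)
        ≤ 2 * π * ((M * min 1 ‖h‖) * (‖h‖ * ‖ξ‖)) * ‖h‖ ^ ((d : ℝ) + s) := by gcongr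
      _ = _ := by ring
  · exact (integrable_min_one_norm_div_rpow hd hs0 hs1).const_mul _
  · refine Filter.Eventually.of_forall fun h l _ => ?_
    have := (((((hasDerivAt_id l).mul_const ⟪h, ξ⟫).const_mul (2 * π)).cos).const_sub 1).div_const
      (‖h‖ ^ ((d : ℝ) + 2 * ((1 + s) / 2)))
    refine this.congr_deriv ?_
    simp only [id]
    ring

/-- Applied to l • ξ with exponent (1+s)/2, the Lévy–Khintchine formula is a multiple of l^(1+s).
Comparing derivatives at l = 1 evaluates the sine integral. -/
theorem integral_sin_mul_inner_div_rpow (hd : 1 ≤ d) {s : ℝ} (hs0 : 0 < s) (hs1 : s < 1) (ξ : E d) :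
    ∫ h : E d, sin (2 * π * ⟪h, ξ⟫) * ⟪h, ξ⟫ / ‖h‖ ^ ((d : ℝ) + s + 1)
      = (1 + s) / (2 * π) * levyConst d ((1 + s) / 2) * ‖ξ‖ ^ (1 + s) := by
  have h1 := hasDerivAt_integral_one_sub_cos hd hs0 hs1 ξ
  have e : ∀ᶠ l in nhds (1 : ℝ),
      ∫ h : E d, (1 - cos (2 * π * (l * ⟪h, ξ⟫))) / ‖h‖ ^ ((d : ℝ) + 2 * ((1 + s) / 2))
        = levyConst d ((1 + s) / 2) * ‖ξ‖ ^ (1 + s) * l ^ (1 + s) := by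
    filter_upwards [lt_mem_nhds (zero_lt_one (α := ℝ))] with l hl
    have := integral_one_sub_cos_div_rpow (d := d) (σ := (1 + s) / 2) (by linarith) (by linarith)
      (l • ξ)
    simp only [inner_smul_right] at this
    rw [this, norm_smul, norm_of_nonneg hl.le, mul_rpow hl.le (norm_nonneg _),
      show 2 * ((1 + s) / 2) = 1 + s by ring]
    ring
  have h2 : HasDerivAt (fun l : ℝ => levyConst d ((1 + s) / 2) * ‖ξ‖ ^ (1 + s) * l ^ (1 + s))
      (levyConst d ((1 + s) / 2) * ‖ξ‖ ^ (1 + s) * ((1 + s) * 1 ^ (1 + s - 1))) 1 :=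
    (hasDerivAt_rpow_const (Or.inl one_ne_zero)).const_mul _
  have h3 := h1.unique (h2.congr_of_eventuallyEq e)
  simp only [mul_div_assoc (2 * π), one_mul, one_rpow, mul_one] at h3
  rw [integral_const_mul, show (d : ℝ) + 2 * ((1 + s) / 2) = d + s + 1 by ring] at h3
  have hpi := pi_pos
  rw [div_mul_eq_mul_div, div_mul_eq_mul_div, eq_div_iff (by positivity), mul_comm, h3]
  ring

/-- The Gamma factors cancel. Squared, the right side is that of `nu_mul_levyConst`, so gradient and
seminorm carry the same factor and the Poincaré constant transfers without loss. -/
theorem mu_mul_levyConst {s : ℝ} (hs0 : 0 < s) (hs1 : s < 1) :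
    mu d s * ((1 + s) / (2 * π) * levyConst d ((1 + s) / 2)) = (2 * π) ^ s := by
  have hG1 := Gamma_pos_of_pos (show 0 < (1 - s) / 2 by linarith)
  have hG2 := Gamma_pos_of_pos (show 0 < ((d : ℝ) + s + 1) / 2 by positivity)
  rw [mu, levyConst, show 1 - (1 + s) / 2 = (1 - s) / 2 by ring,
    show (d : ℝ) / 2 + (1 + s) / 2 = (d + s + 1) / 2 by ring,
    show 2 * ((1 + s) / 2) = s + 1 by ring, rpow_add_one pi_pos.ne', mul_rpow zero_le_two pi_pos.le]
  field_simp

theorem nu_mul_levyConst {s : ℝ} (hs0 : 0 < s) (hs1 : s < 1) :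
    nu d s * levyConst d s = (2 * π) ^ (2 * s) := by
  have hG1 := Gamma_pos_of_pos (show 0 < 1 - s by linarith)
  have hG2 := Gamma_pos_of_pos (show 0 < s + (d : ℝ) / 2 by positivity)
  rw [nu, levyConst, add_comm ((d : ℝ) / 2) s, mul_rpow zero_le_two pi_pos.le]
  field_simp

theorem nu_pos {s : ℝ} (hs0 : 0 < s) (hs1 : s < 1) : 0 < nu d s := by
  have hG1 := Gamma_pos_of_pos (show 0 < 1 - s by linarith)
  have hG2 := Gamma_pos_of_pos (show 0 < s + (d : ℝ) / 2 by positivity)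
  unfold nu
  positivity

end SineKernel

/-! ### The fractional gradient of a test function and its Fourier transform -/

section FracGrad

variable {d : ℕ} {s : ℝ} {φ : E d → ℝ}

/-- The kernel `h / |h| ^ (d + s + 1)` of the fractional gradient. -/
noncomputable def fracKernel (s : ℝ) (h : E d) : E d :=
  (1 / ‖h‖ ^ ((d : ℝ) + s)) • (‖h‖⁻¹ • h)

@[fun_prop]
theorem measurable_fracKernel : Measurable (fracKernel s : E d → E d) := by
  unfold fracKernel
  fun_prop

theorem norm_fracKernel_le (h : E d) : ‖fracKernel s h‖ ≤ 1 / ‖h‖ ^ ((d : ℝ) + s) := by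
  have h0 : 0 ≤ 1 / ‖h‖ ^ ((d : ℝ) + s) := by positivity
  rw [fracKernel, norm_smul, norm_smul, norm_inv, norm_norm, Real.norm_of_nonneg h0]
  exact mul_le_of_le_one_right h0 inv_mul_le_one

theorem fracGrad_eq (w : E d → ℝ) (x : E d) :
    fracGrad s w x = mu d s • ∫ h, (w (x + h) - w x) • fracKernel s h := by
  rw [fracGrad, ← integral_add_left_eq_self _ x]
  congr 2
  ext1 h
  rw [show ‖x - (x + h)‖ = ‖h‖ by rw [sub_add_cancel_left, norm_neg], add_sub_cancel_left,
    fracKernel, smul_smul _ (1 / _) _, mul_one_div]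

/-- The factor min(1, ‖h‖) combines the sup bound and the Lipschitz bound. The indicators record
that the difference vanishes unless x or x + h lies in the support; they make the bound integrable
in x as well. -/
theorem exists_abs_sub_le (hφ : ContDiff ℝ ∞ φ) (hc : HasCompactSupport φ) :
    ∃ C : ℝ, 0 ≤ C ∧ ∀ x h, |φ (x + h) - φ x| ≤ C * min 1 ‖h‖ *
      ((tsupport φ).indicator 1 x + (tsupport φ).indicator 1 (x + h)) := by
  obtain ⟨M, hM⟩ := hc.exists_bound_of_continuous hφ.continuous
  obtain ⟨L, hL⟩ := hφ.lipschitzWith_of_hasCompactSupport hc (by simp)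
  have hM0 : 0 ≤ M := (norm_nonneg _).trans (hM 0)
  refine ⟨max (2 * M) L, by positivity, fun x h => ?_⟩
  have h1 : |φ (x + h) - φ x| ≤ max (2 * M) L * min 1 ‖h‖ := by
    rw [mul_min_of_nonneg _ _ (by positivity), mul_one]
    refine le_min (le_trans ?_ (le_max_left _ _)) ?_
    · refine (abs_sub _ _).trans ?_
      have := hM (x + h)
      have := hM x
      simp only [Real.norm_eq_abs] at *
      linarith
    · have := hL.dist_le_mul (x + h) x
      rw [Real.dist_eq, dist_eq_norm, add_sub_cancel_left] at this
      exact this.trans (by gcongr; exact le_max_right _ _)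
  have hm : 0 ≤ max (2 * M) L * min 1 ‖h‖ := by positivity
  have hnn : ∀ z, 0 ≤ (tsupport φ).indicator (1 : E d → ℝ) z :=
    fun z => Set.indicator_nonneg (fun _ _ => zero_le_one) z
  by_cases hx : x ∈ tsupport φ
  · refine h1.trans (le_mul_of_one_le_right hm ?_)
    rw [Set.indicator_of_mem hx]
    simpa using hnn _
  by_cases hxh : x + h ∈ tsupport φ
  · refine h1.trans (le_mul_of_one_le_right hm ?_)
    rw [Set.indicator_of_mem hxh]
    simpa using hnn _
  · rw [image_eq_zero_of_notMem_tsupport hx, image_eq_zero_of_notMem_tsupport hxh,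
      Set.indicator_of_notMem hx, Set.indicator_of_notMem hxh]
    simp

theorem norm_sub_smul_fracKernel_le {C : ℝ}
    (hC : ∀ x h, |φ (x + h) - φ x| ≤ C * min 1 ‖h‖ *
      ((tsupport φ).indicator 1 x + (tsupport φ).indicator 1 (x + h))) (x h : E d) :
    ‖(φ (x + h) - φ x) • fracKernel s h‖ ≤
      C * ((tsupport φ).indicator 1 x * (min 1 ‖h‖ / ‖h‖ ^ ((d : ℝ) + s))) +
      C * ((tsupport φ).indicator 1 (x + h) * (min 1 ‖h‖ / ‖h‖ ^ ((d : ℝ) + s))) := by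
  rw [norm_smul, Real.norm_eq_abs]
  calc _ ≤ (C * min 1 ‖h‖ * ((tsupport φ).indicator 1 x + (tsupport φ).indicator 1 (x + h))) *
        (1 / ‖h‖ ^ ((d : ℝ) + s)) :=
        mul_le_mul (hC x h) (norm_fracKernel_le h) (norm_nonneg _) ((abs_nonneg _).trans (hC x h))
    _ = _ := by ring

theorem integrable_sub_smul_fracKernel (hd : 1 ≤ d) (hs0 : 0 < s) (hs1 : s < 1)
    (hφ : ContDiff ℝ ∞ φ) (hc : HasCompactSupport φ) (x : E d) :
    Integrable fun h => (φ (x + h) - φ x) • fracKernel s h := by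
  obtain ⟨C, hC0, hC⟩ := exists_abs_sub_le hφ hc
  have hm := integrable_min_one_norm_div_rpow hd hs0 hs1
  have hcont := hφ.continuous
  refine ((hm.const_mul C).add (hm.const_mul C)).mono'
    (Measurable.aestronglyMeasurable (by fun_prop)) (Filter.Eventually.of_forall fun h => ?_)
  refine (norm_sub_smul_fracKernel_le hC x h).trans ?_
  have hi : ∀ z, (tsupport φ).indicator (1 : E d → ℝ) z ≤ 1 :=
    fun z => Set.indicator_le_self' (fun _ _ => zero_le_one) z
  have hp : 0 ≤ min 1 ‖h‖ / ‖h‖ ^ ((d : ℝ) + s) := by positivity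
  exact add_le_add (mul_le_mul_of_nonneg_left (mul_le_of_le_one_left hp (hi _)) hC0)
    (mul_le_mul_of_nonneg_left (mul_le_of_le_one_left hp (hi _)) hC0)

/-- One term of the bound is a product of integrable functions of x and of h; the other is its
composition with the measure-preserving shear (x, h) ↦ (x + h, h). This justifies Fubini for the
Fourier transform. -/
theorem integrable_prod_sub_smul_fracKernel (hd : 1 ≤ d) (hs0 : 0 < s) (hs1 : s < 1)
    (hφ : ContDiff ℝ ∞ φ) (hc : HasCompactSupport φ) :
    Integrable (fun z : E d × E d => (φ (z.1 + z.2) - φ z.1) • fracKernel s z.2)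
      (volume.prod volume) := by
  obtain ⟨C, hC0, hC⟩ := exists_abs_sub_le hφ hc
  have hm := integrable_min_one_norm_div_rpow hd hs0 hs1
  have hcont := hφ.continuous
  have hK : Integrable ((tsupport φ).indicator (1 : E d → ℝ)) := by
    rw [integrable_indicator_iff (isClosed_tsupport φ).measurableSet]
    exact integrableOn_const (hc.isCompact.measure_lt_top.ne) (by simp)
  have h1 := hK.mul_prod hm
  have h2 := (measurePreserving_add_prod (volume : Measure (E d)) (volume : Measure (E d))).integrable_comp_of_integrable h1
  refine ((h1.const_mul C).add (h2.const_mul C)).mono'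
    (Measurable.aestronglyMeasurable (by fun_prop)) (Filter.Eventually.of_forall fun z => ?_)
  exact norm_sub_smul_fracKernel_le hC z.1 z.2

theorem integrable_fracGrad (hd : 1 ≤ d) (hs0 : 0 < s) (hs1 : s < 1)
    (hφ : ContDiff ℝ ∞ φ) (hc : HasCompactSupport φ) : Integrable (fracGrad s φ) := by
  have := ((integrable_prod_sub_smul_fracKernel hd hs0 hs1 hφ hc).integral_prod_left).smul (mu d s)
  refine this.congr (Filter.Eventually.of_forall fun x => ?_)
  simp [fracGrad_eq]

theorem exists_norm_fracGrad_le (hd : 1 ≤ d) (hs0 : 0 < s) (hs1 : s < 1)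
    (hφ : ContDiff ℝ ∞ φ) (hc : HasCompactSupport φ) : ∃ M, ∀ x, ‖fracGrad s φ x‖ ≤ M := by
  obtain ⟨C, hC0, hC⟩ := exists_abs_sub_le hφ hc
  have hm := integrable_min_one_norm_div_rpow hd hs0 hs1
  refine ⟨|mu d s| * ∫ h : E d, (C * (min 1 ‖h‖ / ‖h‖ ^ ((d : ℝ) + s)) +
    C * (min 1 ‖h‖ / ‖h‖ ^ ((d : ℝ) + s))), fun x => ?_⟩
  rw [fracGrad_eq, norm_smul, Real.norm_eq_abs]
  refine mul_le_mul_of_nonneg_left (norm_integral_le_of_norm_le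
    ((hm.const_mul C).add (hm.const_mul C)) (Filter.Eventually.of_forall fun h => ?_)) (abs_nonneg _)
  refine (norm_sub_smul_fracKernel_le hC x h).trans ?_
  have hi : ∀ z, (tsupport φ).indicator (1 : E d → ℝ) z ≤ 1 :=
    fun z => Set.indicator_le_self' (fun _ _ => zero_le_one) z
  have hp : 0 ≤ min 1 ‖h‖ / ‖h‖ ^ ((d : ℝ) + s) := by positivity
  exact add_le_add (mul_le_mul_of_nonneg_left (mul_le_of_le_one_left hp (hi _)) hC0)
    (mul_le_mul_of_nonneg_left (mul_le_of_le_one_left hp (hi _)) hC0)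

/-- The fractional gradient of a test function is square-integrable. -/
theorem memLp_fracGrad (hd : 1 ≤ d) (hs0 : 0 < s) (hs1 : s < 1)
    (hφ : ContDiff ℝ ∞ φ) (hc : HasCompactSupport φ) : MemLp (fracGrad s φ) 2 := by
  obtain ⟨M, hM⟩ := exists_norm_fracGrad_le hd hs0 hs1 hφ hc
  have hi := integrable_fracGrad hd hs0 hs1 hφ hc
  rw [memLp_two_iff_integrable_sq_norm hi.aestronglyMeasurable]
  refine (hi.norm.const_mul M).mono' (hi.aestronglyMeasurable.norm.pow 2)
    (Filter.Eventually.of_forall fun x => ?_)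
  rw [Real.norm_of_nonneg (by positivity), pow_two]
  exact mul_le_mul_of_nonneg_right (hM x) (norm_nonneg _)

theorem fracGrad_add (hd : 1 ≤ d) (hs0 : 0 < s) (hs1 : s < 1) {ψ : E d → ℝ}
    (hφ : ContDiff ℝ ∞ φ) (hc : HasCompactSupport φ)
    (hψ : ContDiff ℝ ∞ ψ) (hc' : HasCompactSupport ψ) (x : E d) :
    fracGrad s (φ + ψ) x = fracGrad s φ x + fracGrad s ψ x := by
  simp only [fracGrad_eq]
  rw [← smul_add, ← integral_add (integrable_sub_smul_fracKernel hd hs0 hs1 hφ hc x)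
    (integrable_sub_smul_fracKernel hd hs0 hs1 hψ hc' x)]
  congr 2
  ext1 h
  rw [← add_smul, Pi.add_apply, Pi.add_apply]
  congr 1; ring

theorem fracGrad_const_smul (c : ℝ) (φ : E d → ℝ) (x : E d) :
    fracGrad s (c • φ) x = c • fracGrad s φ x := by
  simp only [fracGrad_eq]
  rw [smul_comm c]
  congr 1
  rw [← integral_smul]
  congr 1
  funext h
  rw [smul_smul, Pi.smul_apply, Pi.smul_apply, smul_eq_mul, smul_eq_mul, mul_sub]

/-- The Fourier multiplier of the fractional gradient in the direction `v`, up to the factor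
`μ(d,s)`. -/
noncomputable def fracMultiplier (s : ℝ) (ξ v : E d) : ℂ :=
  ∫ h : E d, (Complex.exp ((2 * Real.pi * ⟪h, ξ⟫ : ℝ) * Complex.I) - 1) * (⟪fracKernel s h, v⟫ : ℝ)

theorem integrable_complex_of_test (hφ : ContDiff ℝ ∞ φ) (hc : HasCompactSupport φ) :
    Integrable fun x => (φ x : ℂ) :=
  (hφ.continuous.integrable_of_hasCompactSupport hc).ofReal

theorem fourier_sub_translate (hφ : ContDiff ℝ ∞ φ) (hc : HasCompactSupport φ) (h ξ : E d) :
    𝓕 (fun x => ((φ (x + h) - φ x : ℝ) : ℂ)) ξ =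
      (Complex.exp ((2 * Real.pi * ⟪h, ξ⟫ : ℝ) * Complex.I) - 1) * 𝓕 (fun x => (φ x : ℂ)) ξ := by
  have hi := integrable_complex_of_test hφ hc
  have h1 := fourier_comp_add_right (fun x => (φ x : ℂ)) h ξ
  rw [sub_mul, one_mul, ← h1]
  simp only [Real.fourier_eq]
  rw [← integral_sub ((Real.fourierIntegral_convergent_iff ξ).2 (hi.comp_add_right h))
    ((Real.fourierIntegral_convergent_iff ξ).2 hi)]
  congr 1
  ext1 x
  rw [← smul_sub, Complex.ofReal_sub]

/-- By Fubini the transform in x is taken at fixed h, where translation by h becomes multiplication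
by exp(2πi⟪h, ξ⟫). -/
theorem fourier_inner_fracGrad (hd : 1 ≤ d) (hs0 : 0 < s) (hs1 : s < 1)
    (hφ : ContDiff ℝ ∞ φ) (hc : HasCompactSupport φ) (ξ v : E d) :
    𝓕 (fun x => ((⟪fracGrad s φ x, v⟫ : ℝ) : ℂ)) ξ =
      mu d s * (𝓕 (fun x => (φ x : ℂ)) ξ * fracMultiplier s ξ v) := by
  have hprod := integrable_prod_sub_smul_fracKernel hd hs0 hs1 hφ hc
  have hv : ∀ x, ((⟪fracGrad s φ x, v⟫ : ℝ) : ℂ) =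
      mu d s * ∫ h, (((φ (x + h) - φ x) * ⟪fracKernel s h, v⟫ : ℝ) : ℂ) := by
    intro x
    rw [fracGrad_eq, real_inner_smul_left, Complex.ofReal_mul, integral_complex_ofReal,
      real_inner_comm, ← integral_inner (integrable_sub_smul_fracKernel hd hs0 hs1 hφ hc x)]
    congr 3
    ext1 h
    rw [real_inner_smul_right, real_inner_comm]
  have hint : Integrable (Function.uncurry fun x h : E d =>
      Real.fourierChar (-⟪x, ξ⟫) • (((φ (x + h) - φ x) * ⟪fracKernel s h, v⟫ : ℝ) : ℂ))
      (volume.prod volume) := by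
    have h1 : Integrable (fun z : E d × E d =>
        ((((φ (z.1 + z.2) - φ z.1) * ⟪fracKernel s z.2, v⟫ : ℝ) : ℂ))) (volume.prod volume) := by
      refine Integrable.ofReal ?_
      refine (hprod.inner_const (𝕜 := ℝ) v).congr (Filter.Eventually.of_forall fun z => ?_)
      exact real_inner_smul_left (fracKernel s z.2) v (φ (z.1 + z.2) - φ z.1)
    refine h1.norm.mono' ?_ (Filter.Eventually.of_forall fun z => ?_)
    · have hcont := hφ.continuous
      have : Continuous fun z : E d × E d => (Real.fourierChar (-⟪z.1, ξ⟫) : ℂ) := by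
        have := Real.continuous_fourierChar
        fun_prop
      exact this.aestronglyMeasurable.mul h1.aestronglyMeasurable
    · rw [Function.uncurry, Circle.norm_smul]
  rw [Real.fourier_eq]
  simp_rw [hv]
  calc ∫ x, Real.fourierChar (-⟪x, ξ⟫) •
        ((mu d s : ℂ) * ∫ h, (((φ (x + h) - φ x) * ⟪fracKernel s h, v⟫ : ℝ) : ℂ))
      = mu d s * ∫ x, ∫ h, Real.fourierChar (-⟪x, ξ⟫) •
          (((φ (x + h) - φ x) * ⟪fracKernel s h, v⟫ : ℝ) : ℂ) := by
        rw [← integral_const_mul]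
        congr 1; funext x
        simp_rw [Circle.smul_def, smul_eq_mul]
        rw [mul_left_comm, integral_const_mul]
    _ = mu d s * ∫ h, ∫ x, Real.fourierChar (-⟪x, ξ⟫) •
          (((φ (x + h) - φ x) * ⟪fracKernel s h, v⟫ : ℝ) : ℂ) := by
        rw [integral_integral_swap hint]
    _ = _ := by
        congr 1
        rw [fracMultiplier, ← integral_const_mul]
        congr 1; funext h
        have := fourier_sub_translate hφ hc h ξ
        rw [Real.fourier_eq] at this
        rw [← mul_assoc, mul_comm (𝓕 (fun x => (φ x : ℂ)) ξ), ← this, ← integral_mul_const]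
        congr 1; funext x
        rw [smul_mul_assoc, Complex.ofReal_mul]

theorem integrable_fracMultiplier (hd : 1 ≤ d) (hs0 : 0 < s) (hs1 : s < 1) (ξ v : E d) :
    Integrable fun h : E d =>
      (Complex.exp ((2 * Real.pi * ⟪h, ξ⟫ : ℝ) * Complex.I) - 1) * (⟪fracKernel s h, v⟫ : ℝ) := by
  have hm := integrable_min_one_norm_div_rpow hd hs0 hs1
  refine (hm.const_mul (max 2 (2 * Real.pi * ‖ξ‖) * ‖v‖)).mono'
    (Measurable.aestronglyMeasurable (by fun_prop)) (Filter.Eventually.of_forall fun h => ?_)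
  have h1 : ‖Complex.exp ((2 * Real.pi * ⟪h, ξ⟫ : ℝ) * Complex.I) - 1‖ ≤
      max 2 (2 * Real.pi * ‖ξ‖) * min 1 ‖h‖ := by
    rw [mul_min_of_nonneg _ _ (by positivity), mul_one]
    refine le_min (le_trans ?_ (le_max_left _ _)) ?_
    · refine (norm_sub_le _ _).trans ?_
      rw [Complex.norm_exp_ofReal_mul_I, norm_one]
      norm_num
    · rw [mul_comm _ Complex.I]
      refine (Real.norm_exp_I_mul_ofReal_sub_one_le).trans ?_
      rw [Real.norm_eq_abs, abs_mul, abs_mul, abs_two, abs_of_pos Real.pi_pos]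
      calc 2 * Real.pi * |⟪h, ξ⟫| ≤ 2 * Real.pi * (‖h‖ * ‖ξ‖) := by
            gcongr; exact abs_real_inner_le_norm h ξ
        _ = (2 * Real.pi * ‖ξ‖) * ‖h‖ := by ring
        _ ≤ _ := by gcongr; exact le_max_right _ _
  have h2 : ‖((⟪fracKernel s h, v⟫ : ℝ) : ℂ)‖ ≤ 1 / ‖h‖ ^ ((d : ℝ) + s) * ‖v‖ := by
    rw [Complex.norm_real]
    refine (abs_real_inner_le_norm _ _).trans ?_
    gcongr
    exact norm_fracKernel_le h
  rw [norm_mul]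
  calc _ ≤ (max 2 (2 * Real.pi * ‖ξ‖) * min 1 ‖h‖) * (1 / ‖h‖ ^ ((d : ℝ) + s) * ‖v‖) := by gcongr
    _ = _ := by ring

/-- The imaginary part of exp(2πi⟪h, ξ⟫) - 1 is the sine, so the sine integral gives the value. A
lower bound on the symbol needs nothing about its real part. -/
theorem im_fracMultiplier_self (hd : 1 ≤ d) (hs0 : 0 < s) (hs1 : s < 1) (ξ : E d) :
    (fracMultiplier s ξ ξ).im =
      (1 + s) / (2 * Real.pi) * levyConst d ((1 + s) / 2) * ‖ξ‖ ^ (1 + s) := by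
  have h := integral_im (integrable_fracMultiplier hd hs0 hs1 ξ ξ)
  rw [← integral_sin_mul_inner_div_rpow hd hs0 hs1, fracMultiplier, ← RCLike.im_eq_complex_im, ← h]
  congr 1; ext1 h
  rw [RCLike.im_eq_complex_im, Complex.im_mul_ofReal, Complex.sub_im, Complex.exp_ofReal_mul_I_im,
    Complex.one_im, sub_zero, fracKernel, real_inner_smul_left, real_inner_smul_left]
  rcases eq_or_ne h 0 with rfl | hh
  · simp
  · rw [Real.rpow_add_one (norm_pos_iff.2 hh).ne']
    field_simp

end FracGrad

/-! ### The Gagliardo seminorm is bounded by the fractional gradient -/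

section Gagliardo

variable {d : ℕ} {s : ℝ} {φ : E d → ℝ}

theorem mu_pos (hs0 : 0 < s) (hs1 : s < 1) : 0 < mu d s := by
  have hG1 := Real.Gamma_pos_of_pos (show 0 < (1 - s) / 2 by linarith)
  have hG2 := Real.Gamma_pos_of_pos (show 0 < ((d : ℝ) + s + 1) / 2 by positivity)
  unfold mu
  positivity

theorem fourier_finset_sum_smul {ι : Type*} (S : Finset ι) (c : ι → ℝ) (u : ι → E d → ℝ)
    (hu : ∀ i ∈ S, Integrable (u i)) (ξ : E d) :
    𝓕 (fun x => ((∑ i ∈ S, c i * u i x : ℝ) : ℂ)) ξ =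
      ∑ i ∈ S, (c i : ℂ) * 𝓕 (fun x => (u i x : ℂ)) ξ := by
  simp only [Real.fourier_eq, Circle.smul_def, smul_eq_mul]
  simp_rw [← integral_const_mul]
  rw [← integral_finsetSum]
  · congr 1; funext x
    push_cast
    rw [Finset.mul_sum]
    exact Finset.sum_congr rfl fun i _ => by ring
  · intro i hi
    have := (Real.fourierIntegral_convergent_iff (f := fun x => (u i x : ℂ)) ξ).2 (hu i hi).ofReal
    simp only [Circle.smul_def, smul_eq_mul] at this
    exact this.const_mul _

/-- A lower bound for the Fourier transform of the fractional gradient. -/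
theorem sq_norm_fourier_le_sum (hd : 1 ≤ d) (hs0 : 0 < s) (hs1 : s < 1)
    (hφ : ContDiff ℝ ∞ φ) (hc : HasCompactSupport φ) (ξ : E d) :
    (2 * Real.pi) ^ (2 * s) * ‖ξ‖ ^ (2 * s) * ‖𝓕 (fun x => (φ x : ℂ)) ξ‖ ^ 2 ≤
      ∑ i, ‖𝓕 (fun x => ((fracGrad s φ x i : ℝ) : ℂ)) ξ‖ ^ 2 := by
  rcases eq_or_ne ξ 0 with rfl | hξ
  · rw [norm_zero, Real.zero_rpow (by positivity), mul_zero, zero_mul]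
    positivity
  have hξ' : 0 < ‖ξ‖ := norm_pos_iff.2 hξ
  have hi := integrable_fracGrad hd hs0 hs1 hφ hc
  have hcomp : ∀ i : Fin d, Integrable fun x => fracGrad s φ x i := fun i =>
    (EuclideanSpace.proj (𝕜 := ℝ) i).integrable_comp hi
  have h1 := fourier_finset_sum_smul Finset.univ (fun i => ξ i) (fun i x => fracGrad s φ x i)
    (fun i _ => hcomp i) ξ
  have h2 := fourier_inner_fracGrad hd hs0 hs1 hφ hc ξ ξ
  have h3 : (fun x => ((⟪fracGrad s φ x, ξ⟫ : ℝ) : ℂ)) =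
      fun x => ((∑ i, ξ i * fracGrad s φ x i : ℝ) : ℂ) := by
    funext x
    rw [PiLp.inner_apply]
    rfl
  rw [h3, h1] at h2
  have hmu := mu_pos (d := d) hs0 hs1
  -- The transform of ⟪grad^s φ, ξ⟫ is bounded below through the imaginary part of the symbol alone.
  have him : (2 * Real.pi) ^ s * ‖ξ‖ ^ (1 + s) * ‖𝓕 (fun x => (φ x : ℂ)) ξ‖ ≤
      ‖∑ i, (ξ i : ℂ) * 𝓕 (fun x => ((fracGrad s φ x i : ℝ) : ℂ)) ξ‖ := by
    rw [h2, norm_mul, norm_mul, Complex.norm_real, Real.norm_of_nonneg hmu.le,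
      ← mu_mul_levyConst (d := d) hs0 hs1]
    calc _ = mu d s * (‖𝓕 (fun x => (φ x : ℂ)) ξ‖ * (fracMultiplier s ξ ξ).im) := by
          rw [im_fracMultiplier_self hd hs0 hs1]; ring
      _ ≤ _ := by gcongr; exact (le_abs_self _).trans (Complex.abs_im_le_norm _)
  -- Cauchy–Schwarz over the components costs a factor ‖ξ‖², which is divided out at the end; hence
  -- the separate case ξ = 0.
  have hcs : ‖∑ i, (ξ i : ℂ) * 𝓕 (fun x => ((fracGrad s φ x i : ℝ) : ℂ)) ξ‖ ^ 2 ≤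
      ‖ξ‖ ^ 2 * ∑ i, ‖𝓕 (fun x => ((fracGrad s φ x i : ℝ) : ℂ)) ξ‖ ^ 2 := by
    have h5 : ‖∑ i, (ξ i : ℂ) * 𝓕 (fun x => ((fracGrad s φ x i : ℝ) : ℂ)) ξ‖ ≤
        ∑ i, ‖ξ i‖ * ‖𝓕 (fun x => ((fracGrad s φ x i : ℝ) : ℂ)) ξ‖ := by
      refine (norm_sum_le _ _).trans (le_of_eq (Finset.sum_congr rfl fun i _ => ?_))
      rw [norm_mul, Complex.norm_real]
    rw [EuclideanSpace.norm_sq_eq]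
    exact (pow_le_pow_left₀ (norm_nonneg _) h5 2).trans (Finset.sum_mul_sq_le_sq_mul_sq _ _ _)
  have h6 := (pow_le_pow_left₀ (by positivity) him 2).trans hcs
  refine le_of_mul_le_mul_left (le_trans (le_of_eq ?_) h6) (pow_pos hξ' 2)
  rw [mul_pow, mul_pow, ← Real.rpow_mul_natCast (by positivity), ← Real.rpow_mul_natCast hξ'.le,
    show (1 + s) * ((2 : ℕ) : ℝ) = 2 + 2 * s by push_cast; ring, Real.rpow_add hξ', Real.rpow_two,
    show s * ((2 : ℕ) : ℝ) = 2 * s by push_cast; ring]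
  ring

theorem norm_exp_mul_I_sub_one_sq (θ : ℝ) :
    ‖Complex.exp (θ * Complex.I) - 1‖ ^ 2 = 2 * (1 - Real.cos θ) := by
  rw [← Complex.normSq_eq_norm_sq, Complex.normSq_apply]
  simp only [Complex.sub_re, Complex.sub_im, Complex.exp_ofReal_mul_I_re, Complex.one_re,
    Complex.exp_ofReal_mul_I_im, Complex.one_im]
  nlinarith [Real.sin_sq_add_cos_sq θ]

/-- Plancherel: the difference has Fourier factor exp(2πi⟪h, ξ⟫) - 1, of squared modulus 2 (1 -
cos). -/
theorem lintegral_sq_translate_sub (hφ : ContDiff ℝ ∞ φ) (hc : HasCompactSupport φ) (h : E d) :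
    ∫⁻ x, ENNReal.ofReal (|φ (x + h) - φ x| ^ 2) =
      ∫⁻ ξ, ENNReal.ofReal (2 * (1 - Real.cos (2 * Real.pi * ⟪h, ξ⟫))) *
        ENNReal.ofReal (‖𝓕 (fun x => (φ x : ℂ)) ξ‖ ^ 2) := by
  have hcont := hφ.continuous
  have hi : Integrable fun x => ((φ (x + h) - φ x : ℝ) : ℂ) :=
    (((hcont.integrable_of_hasCompactSupport hc).comp_add_right h).sub
      (hcont.integrable_of_hasCompactSupport hc)).ofReal
  have hm : MemLp (fun x => ((φ (x + h) - φ x : ℝ) : ℂ)) 2 := by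
    have h1 : MemLp φ 2 := hcont.memLp_of_hasCompactSupport hc
    have h2 : MemLp (fun x => φ (x + h)) 2 :=
      h1.comp_measurePreserving (measurePreserving_add_right volume h)
    exact (h2.sub h1).ofReal
  have e : ∀ z : ℂ, ‖z‖ₑ ^ 2 = ENNReal.ofReal (‖z‖ ^ 2) := fun z => by
    rw [ENNReal.ofReal_pow (norm_nonneg _), ofReal_norm]
  have key := lintegral_enorm_sq_fourier hi hm
  simp_rw [e, Complex.norm_real, Real.norm_eq_abs] at key
  rw [← key]
  refine lintegral_congr fun ξ => ?_
  rw [fourier_sub_translate hφ hc, norm_mul, mul_pow, norm_exp_mul_I_sub_one_sq,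
    ENNReal.ofReal_mul]
  have := Real.cos_le_one (2 * Real.pi * ⟪h, ξ⟫)
  linarith

/-- The Gagliardo seminorm of a test function in terms of its Fourier transform. -/
theorem gagliardoSq_eq_lintegral_fourier (hs0 : 0 < s) (hs1 : s < 1)
    (hφ : ContDiff ℝ ∞ φ) (hc : HasCompactSupport φ) :
    gagliardoSq s φ = ∫⁻ ξ : E d, ENNReal.ofReal
      ((2 * Real.pi) ^ (2 * s) * ‖ξ‖ ^ (2 * s) * ‖𝓕 (fun x => (φ x : ℂ)) ξ‖ ^ 2) := by
  have hcont := hφ.continuous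
  have hFc : Continuous (𝓕 fun x => (φ x : ℂ)) :=
    VectorFourier.fourierIntegral_continuous Real.continuous_fourierChar continuous_inner
      (integrable_complex_of_test hφ hc)
  have hν := nu_pos (d := d) hs0 hs1
  -- Substitute x = y + h, apply Plancherel in y at fixed h, then swap and apply Lévy–Khintchine in
  -- h at fixed ξ. All integrands are nonnegative, so Tonelli needs no finiteness.
  calc gagliardoSq s φ
      = ENNReal.ofReal (nu d s / 2) * ∫⁻ y : E d, ∫⁻ h : E d,
          ENNReal.ofReal (1 / ‖h‖ ^ ((d : ℝ) + 2 * s)) *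
            ENNReal.ofReal (|φ (y + h) - φ y| ^ 2) := by
        rw [gagliardoSq]
        congr 1
        refine lintegral_congr fun y => ?_
        rw [← lintegral_add_left_eq_self _ y]
        refine lintegral_congr fun h => ?_
        rw [← ENNReal.ofReal_mul (by positivity), add_sub_cancel_left, one_div_mul_eq_div]
    _ = ENNReal.ofReal (nu d s / 2) * ∫⁻ h : E d, ∫⁻ y : E d,
          ENNReal.ofReal (1 / ‖h‖ ^ ((d : ℝ) + 2 * s)) *
            ENNReal.ofReal (|φ (y + h) - φ y| ^ 2) := by
        rw [lintegral_lintegral_swap (Measurable.aemeasurable (by fun_prop))]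
    _ = ENNReal.ofReal (nu d s / 2) * ∫⁻ h : E d, ∫⁻ ξ : E d,
          (ENNReal.ofReal 2 * ENNReal.ofReal (‖𝓕 (fun x => (φ x : ℂ)) ξ‖ ^ 2)) *
          ENNReal.ofReal ((1 - Real.cos (2 * Real.pi * ⟪h, ξ⟫)) / ‖h‖ ^ ((d : ℝ) + 2 * s)) := by
        congr 1
        refine lintegral_congr fun h => ?_
        rw [lintegral_const_mul' _ _ ENNReal.ofReal_ne_top, lintegral_sq_translate_sub hφ hc,
          ← lintegral_const_mul' _ _ ENNReal.ofReal_ne_top]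
        refine lintegral_congr fun ξ => ?_
        have := Real.cos_le_one (2 * Real.pi * ⟪h, ξ⟫)
        rw [← ENNReal.ofReal_mul (by linarith), ← ENNReal.ofReal_mul (by positivity),
          ← ENNReal.ofReal_mul (by positivity), ← ENNReal.ofReal_mul (by positivity)]
        congr 1; ring
    _ = ENNReal.ofReal (nu d s / 2) * ∫⁻ ξ : E d, ∫⁻ h : E d,
          (ENNReal.ofReal 2 * ENNReal.ofReal (‖𝓕 (fun x => (φ x : ℂ)) ξ‖ ^ 2)) *
          ENNReal.ofReal ((1 - Real.cos (2 * Real.pi * ⟪h, ξ⟫)) / ‖h‖ ^ ((d : ℝ) + 2 * s)) := by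
        rw [lintegral_lintegral_swap (Measurable.aemeasurable ?_)]
        have := hFc.measurable
        fun_prop
    _ = _ := by
        rw [← lintegral_const_mul' _ _ ENNReal.ofReal_ne_top]
        refine lintegral_congr fun ξ => ?_
        rw [lintegral_const_mul' _ _ (by finiteness), lintegral_one_sub_cos_div_rpow hs0 hs1,
          ← ENNReal.ofReal_mul (by positivity), ← ENNReal.ofReal_mul (by positivity),
          ← ENNReal.ofReal_mul (by positivity), ← nu_mul_levyConst (d := d) hs0 hs1]
        congr 1; ring

/-- The Gagliardo seminorm of a test function is controlled by its fractional gradient. -/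
theorem gagliardoSq_le_lintegral_fracGrad (hd : 1 ≤ d) (hs0 : 0 < s) (hs1 : s < 1)
    (hφ : ContDiff ℝ ∞ φ) (hc : HasCompactSupport φ) :
    gagliardoSq s φ ≤ ∫⁻ x, ‖fracGrad s φ x‖ₑ ^ 2 := by
  have hi := integrable_fracGrad hd hs0 hs1 hφ hc
  have hm := memLp_fracGrad hd hs0 hs1 hφ hc
  have hci : ∀ i : Fin d, Integrable fun x => ((fracGrad s φ x i : ℝ) : ℂ) := fun i =>
    ((EuclideanSpace.proj (𝕜 := ℝ) i).integrable_comp hi).ofReal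
  have hcm : ∀ i : Fin d, MemLp (fun x => ((fracGrad s φ x i : ℝ) : ℂ)) 2 := fun i =>
    ((EuclideanSpace.proj (𝕜 := ℝ) i).comp_memLp' hm).ofReal
  have e : ∀ z : ℂ, ‖z‖ₑ ^ 2 = ENNReal.ofReal (‖z‖ ^ 2) := fun z => by
    rw [ENNReal.ofReal_pow (norm_nonneg _), ofReal_norm]
  have hFc : ∀ i : Fin d, Continuous (𝓕 fun x => ((fracGrad s φ x i : ℝ) : ℂ)) := fun i =>
    VectorFourier.fourierIntegral_continuous Real.continuous_fourierChar continuous_inner (hci i)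
  rw [gagliardoSq_eq_lintegral_fourier hs0 hs1 hφ hc]
  calc _ ≤ ∫⁻ ξ : E d, ∑ i, ‖𝓕 (fun x => ((fracGrad s φ x i : ℝ) : ℂ)) ξ‖ₑ ^ 2 := by
        refine lintegral_mono fun ξ => ?_
        refine (ENNReal.ofReal_le_ofReal (sq_norm_fourier_le_sum hd hs0 hs1 hφ hc ξ)).trans ?_
        rw [ENNReal.ofReal_sum_of_nonneg fun i _ => by positivity]
        simp_rw [e]
        rfl
    _ = ∑ i, ∫⁻ x : E d, ‖((fracGrad s φ x i : ℝ) : ℂ)‖ₑ ^ 2 := by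
        rw [lintegral_finsetSum _ fun i _ => by
          have := (hFc i).measurable
          fun_prop]
        exact Finset.sum_congr rfl fun i _ => lintegral_enorm_sq_fourier (hci i) (hcm i)
    _ = ∫⁻ x : E d, ∑ i, ‖((fracGrad s φ x i : ℝ) : ℂ)‖ₑ ^ 2 := by
        rw [lintegral_finsetSum' _ fun i _ => ((hci i).aestronglyMeasurable.enorm).pow_const 2]
    _ = _ := by
        refine lintegral_congr fun x => ?_
        rw [← ofReal_norm, ← ENNReal.ofReal_pow (norm_nonneg _), EuclideanSpace.norm_sq_eq,
          ENNReal.ofReal_sum_of_nonneg fun i _ => by positivity]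
        simp_rw [e, Complex.norm_real]

end Gagliardo

/-! ### The fractional Poincaré inequality -/

section Poincare

variable {d : ℕ} {s : ℝ} {Ω : Set (E d)}

theorem gagliardoSq_congr_ae {v w : E d → ℝ} (h : v =ᵐ[volume] w) :
    gagliardoSq s v = gagliardoSq s w := by
  unfold gagliardoSq
  congr 1
  refine lintegral_congr_ae ?_
  filter_upwards [h] with y hy
  refine lintegral_congr_ae ?_
  filter_upwards [h] with x hx
  rw [hx, hy]

/-- On a ball A away from Ω the function vanishes, so |w(x) - w(y)| = |w(x)| for almost every y in
A. Keeping only x in Ω and y in A, where ‖x - y‖ is bounded, leaves a multiple of the integral of w²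
over Ω. -/
theorem exists_mul_sq_le_gagliardoSq (hd : 1 ≤ d) (hs0 : 0 < s) (hs1 : s < 1)
    (hΩo : IsOpen Ω) (hΩb : Bornology.IsBounded Ω) :
    ∃ c : ℝ≥0∞, c ≠ 0 ∧ c ≠ ⊤ ∧ ∀ w : E d → ℝ, (∀ᵐ x, x ∉ closure Ω → w x = 0) →
      c * eLpNorm w 2 (volume.restrict Ω) ^ 2 ≤ gagliardoSq s w := by
  have : NeZero d := ⟨by omega⟩
  obtain ⟨R, hR0, hR⟩ := hΩb.exists_pos_norm_le
  -- The unit ball about a point of norm R + 2 stays outside radius R + 1 and inside R + 3; so it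
  -- misses the closure of Ω, and distances to Ω are at most R + (R + 3) = D.
  obtain ⟨z, hz⟩ := exists_norm_eq (E d) (show 0 ≤ R + 2 by positivity)
  set A := Metric.ball z 1 with hA
  set D : ℝ := 2 * R + 3 with hD
  have hD0 : 0 < D := by positivity
  have hyA : ∀ y ∈ A, R + 1 < ‖y‖ ∧ ‖y‖ < R + 3 := by
    intro y hy
    rw [hA, Metric.mem_ball, dist_eq_norm] at hy
    have h1 := norm_sub_norm_le z y
    have h2 := norm_sub_norm_le y z
    rw [norm_sub_rev] at h1
    constructor <;> linarith
  have hcl : ∀ y ∈ A, y ∉ closure Ω := by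
    intro y hy hcl
    have : closure Ω ⊆ Metric.closedBall 0 R :=
      closure_minimal (fun x hx => by simpa using hR x hx) Metric.isClosed_closedBall
    have h3 := this hcl
    rw [mem_closedBall_zero_iff] at h3
    linarith [(hyA y hy).1]
  have hν := nu_pos (d := d) hs0 hs1
  have hA0 : volume A ≠ 0 := (Metric.measure_ball_pos volume z one_pos).ne'
  have hAt : volume A ≠ ⊤ := measure_ball_lt_top.ne
  have hp : 0 < 1 / D ^ ((d : ℝ) + 2 * s) := by positivity
  refine ⟨ENNReal.ofReal (nu d s / 2) * (ENNReal.ofReal (1 / D ^ ((d : ℝ) + 2 * s)) * volume A),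
    ?_, ?_, fun w hw => ?_⟩
  · have h1 : ENNReal.ofReal (nu d s / 2) ≠ 0 := (ENNReal.ofReal_pos.2 (by positivity)).ne'
    have h2 : ENNReal.ofReal (1 / D ^ ((d : ℝ) + 2 * s)) ≠ 0 := (ENNReal.ofReal_pos.2 hp).ne'
    exact mul_ne_zero h1 (mul_ne_zero h2 hA0)
  · finiteness
  · rw [← lintegral_enorm_sq_eq_eLpNorm_sq, gagliardoSq, mul_assoc]
    gcongr
    calc _ = ∫⁻ _ in A, ENNReal.ofReal (1 / D ^ ((d : ℝ) + 2 * s)) * ∫⁻ x in Ω, ‖w x‖ₑ ^ 2 := by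
          rw [setLIntegral_const]; ring
      _ ≤ ∫⁻ y in A, ∫⁻ x, ENNReal.ofReal (|w x - w y| ^ 2 / ‖x - y‖ ^ ((d : ℝ) + 2 * s)) := by
          refine lintegral_mono_ae ?_
          rw [ae_restrict_iff' Metric.isOpen_ball.measurableSet]
          filter_upwards [hw] with y hy hyA'
          rw [hy (hcl y hyA'), ← lintegral_const_mul' _ _ ENNReal.ofReal_ne_top]
          refine le_trans ?_ (setLIntegral_le_lintegral Ω _)
          refine setLIntegral_mono' hΩo.measurableSet fun x hx => ?_
          rw [← ofReal_norm, ← ENNReal.ofReal_pow (norm_nonneg _), ← ENNReal.ofReal_mul hp.le,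
            sub_zero, Real.norm_eq_abs, one_div_mul_eq_div]
          refine ENNReal.ofReal_le_ofReal ?_
          have h1 : ‖x‖ ≤ R := hR x hx
          have h2 := hyA y hyA'
          have h3 : 0 < ‖x - y‖ := by
            have := norm_sub_norm_le y x
            rw [norm_sub_rev] at this
            linarith
          have h4 : ‖x - y‖ ≤ D := (norm_sub_le x y).trans (by rw [hD]; linarith)
          gcongr
      _ ≤ _ := setLIntegral_le_lintegral A _

/-- The fractional Poincaré inequality on a bounded open set. -/
theorem exists_isPoincareConstant (hd : 1 ≤ d) (hs0 : 0 < s) (hs1 : s < 1)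
    (hΩo : IsOpen Ω) (hΩb : Bornology.IsBounded Ω) : ∃ C, IsPoincareConstant s Ω C := by
  obtain ⟨c, hc0, hct, hc⟩ := exists_mul_sq_le_gagliardoSq hd hs0 hs1 hΩo hΩb
  have hcr : 0 < c.toReal := ENNReal.toReal_pos hc0 hct
  refine ⟨Real.sqrt (c.toReal⁻¹), Real.sqrt_nonneg _, fun w hw => ?_⟩
  have h := ENNReal.toReal_mono hw.1.ne (hc w hw.2)
  rw [ENNReal.toReal_mul, ENNReal.toReal_pow] at h
  rw [hsSeminorm, ← Real.sqrt_mul (by positivity)]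
  refine Real.le_sqrt_of_sq_le ?_
  rw [inv_mul_eq_div, le_div_iff₀ hcr, mul_comm]
  exact h

/-- The Poincaré inequality for test functions in terms of the fractional gradient. -/
theorem IsPoincareConstant.eLpNorm_le_fracGrad (hd : 1 ≤ d) (hs0 : 0 < s) (hs1 : s < 1) {C : ℝ}
    (hC : IsPoincareConstant s Ω C) {φ : E d → ℝ} (hφ : IsTestFunction Ω φ) :
    (eLpNorm φ 2 (volume.restrict Ω)).toReal ≤ C * (eLpNorm (fracGrad s φ) 2 volume).toReal := by
  have hm : MemLp φ 2 (volume : Measure (E d)) :=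
    hφ.1.continuous.memLp_of_hasCompactSupport hφ.2.1
  have hg := memLp_fracGrad hd hs0 hs1 hφ.1 hφ.2.1
  have hle := gagliardoSq_le_lintegral_fracGrad hd hs0 hs1 hφ.1 hφ.2.1
  rw [lintegral_enorm_sq_eq_eLpNorm_sq] at hle
  have hfin : eLpNorm (fracGrad s φ) 2 volume ^ 2 ≠ ⊤ := ENNReal.pow_ne_top hg.2.ne
  have hae := hm.coeFn_toLp
  -- Finiteness of the seminorm comes from the gradient bound itself.
  have hw : hm.toLp φ ∈ TildeHs s Ω := by
    refine ⟨?_, ?_⟩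
    · rw [gagliardoSq_congr_ae hae]
      exact hle.trans_lt hfin.lt_top
    · filter_upwards [hae] with x hx hxΩ
      rw [hx]
      exact image_eq_zero_of_notMem_tsupport fun h => hxΩ (subset_closure (hφ.2.2 h))
  have h := hC.2 _ hw
  rw [eLpNorm_congr_ae (ae_restrict_of_ae hae), hsSeminorm, gagliardoSq_congr_ae hae] at h
  refine h.trans (mul_le_mul_of_nonneg_left ?_ hC.1)
  refine Real.sqrt_le_iff.2 ⟨ENNReal.toReal_nonneg, ?_⟩
  rw [← ENNReal.toReal_pow]
  exact ENNReal.toReal_mono hfin hle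

end Poincare

/-! ### The mixed problem on the closed graph of the gradient -/

section Mixed

variable {d : ℕ} {s : ℝ} {Ω : Set (E d)}

theorem inner_L2On (a b : L2On Ω) : ⟪a, b⟫ = ∫ x in Ω, a x * b x := by
  rw [L2.inner_def]
  refine integral_congr_ae (Filter.Eventually.of_forall fun x => ?_)
  simp [mul_comm]

theorem exists_extension_by_zero (hΩ : MeasurableSet Ω) (a : L2On Ω) :
    ∃ p ∈ TildeL2 Ω, p =ᵐ[volume.restrict Ω] a ∧ ‖p‖ = ‖a‖ := by
  have hm : MemLp (Ω.indicator a) 2 (volume : Measure (E d)) :=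
    (memLp_indicator_iff_restrict hΩ).2 (Lp.memLp a)
  refine ⟨hm.toLp _, ?_, ?_, ?_⟩
  · filter_upwards [hm.coeFn_toLp] with x hx hxΩ
    rw [hx, Set.indicator_of_notMem hxΩ]
  · filter_upwards [ae_restrict_of_ae hm.coeFn_toLp, ae_restrict_mem hΩ] with x hx hxΩ
    rw [hx, Set.indicator_of_mem hxΩ]
  · rw [Lp.norm_toLp, eLpNorm_indicator_eq_eLpNorm_restrict hΩ, Lp.norm_def]

theorem ae_eq_of_mem_tildeL2 {p q : L2 d} (hΩ : MeasurableSet Ω) (hp : p ∈ TildeL2 Ω)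
    (hq : q ∈ TildeL2 Ω) (h : p =ᵐ[volume.restrict Ω] q) : p = q := by
  apply Lp.ext
  rw [Filter.EventuallyEq, ae_restrict_iff' hΩ] at h
  filter_upwards [h, hp, hq] with x hx hpx hqx
  by_cases hxΩ : x ∈ Ω
  · exact hx hxΩ
  · rw [hpx hxΩ, hqx hxΩ]

theorem IsTestFunction.memLp_restrict {φ : E d → ℝ} (hφ : IsTestFunction Ω φ) :
    MemLp φ 2 (volume.restrict Ω) :=
  (hφ.1.continuous.memLp_of_hasCompactSupport hφ.2.1).restrict Ω

theorem IsTestFunction.add {φ ψ : E d → ℝ} (hφ : IsTestFunction Ω φ) (hψ : IsTestFunction Ω ψ) :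
    IsTestFunction Ω (φ + ψ) :=
  ⟨hφ.1.add hψ.1, hφ.2.1.add hψ.2.1,
    (tsupport_add φ ψ).trans (Set.union_subset hφ.2.2 hψ.2.2)⟩

theorem IsTestFunction.const_smul {φ : E d → ℝ} (c : ℝ) (hφ : IsTestFunction Ω φ) :
    IsTestFunction Ω (c • φ) :=
  ⟨contDiff_const.smul hφ.1, hφ.2.1.smul_left (f := fun _ => c),
    (closure_mono (Function.support_const_smul_subset c φ)).trans hφ.2.2⟩

theorem isTestFunction_zero : IsTestFunction Ω (0 : E d → ℝ) :=
  ⟨contDiff_const, HasCompactSupport.zero, by simp [tsupport]⟩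

/-- The product of `L²(Ω)` and `L²(ℝ^d)^d` as a Hilbert space. -/
abbrev MixedSpace (Ω : Set (E d)) : Type := WithLp 2 (L2On Ω × L2Vec d)

/-- The graph of the fractional gradient on test functions. -/
def gradGraph (hd : 1 ≤ d) (hs0 : 0 < s) (hs1 : s < 1) (Ω : Set (E d)) :
    Submodule ℝ (MixedSpace Ω) where
  carrier := {z | ∃ φ, IsTestFunction Ω φ ∧ z.fst =ᵐ[volume.restrict Ω] φ ∧
    z.snd =ᵐ[volume] fracGrad s φ}
  zero_mem' := by
    refine ⟨0, isTestFunction_zero, Lp.coeFn_zero _ _ _, (Lp.coeFn_zero _ _ _).trans ?_⟩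
    refine Filter.Eventually.of_forall fun x => ?_
    simp [fracGrad]
  add_mem' := by
    rintro y z ⟨φ, hφ, h1, h2⟩ ⟨ψ, hψ, h3, h4⟩
    refine ⟨φ + ψ, hφ.add hψ, (Lp.coeFn_add _ _).trans (h1.add h3),
      (Lp.coeFn_add _ _).trans ((h2.add h4).trans ?_)⟩
    exact Filter.Eventually.of_forall fun x =>
      (fracGrad_add hd hs0 hs1 hφ.1 hφ.2.1 hψ.1 hψ.2.1 x).symm
  smul_mem' := by
    rintro c z ⟨φ, hφ, h1, h2⟩
    refine ⟨c • φ, hφ.const_smul c, (Lp.coeFn_smul _ _).trans (h1.const_smul c),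
      (Lp.coeFn_smul _ _).trans ((h2.const_smul c).trans ?_)⟩
    exact Filter.Eventually.of_forall fun x => (fracGrad_const_smul c φ x).symm

theorem exists_mem_gradGraph (hd : 1 ≤ d) (hs0 : 0 < s) (hs1 : s < 1) {φ : E d → ℝ}
    (hφ : IsTestFunction Ω φ) : ∃ z ∈ gradGraph hd hs0 hs1 Ω,
      z.fst =ᵐ[volume.restrict Ω] φ ∧ z.snd =ᵐ[volume] fracGrad s φ := by
  have h1 := hφ.memLp_restrict.coeFn_toLp
  have h2 := (memLp_fracGrad hd hs0 hs1 hφ.1 hφ.2.1).coeFn_toLp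
  exact ⟨WithLp.toLp 2 (hφ.memLp_restrict.toLp φ, (memLp_fracGrad hd hs0 hs1 hφ.1 hφ.2.1).toLp _),
    ⟨φ, hφ, h1, h2⟩, h1, h2⟩

/-- The Poincaré inequality is a closed condition on pairs, so it survives the passage from test
functions to the closure. -/
theorem norm_fst_le_of_mem_closure (hd : 1 ≤ d) (hs0 : 0 < s) (hs1 : s < 1) {C : ℝ}
    (hC : IsPoincareConstant s Ω C) {z : MixedSpace Ω}
    (hz : z ∈ (gradGraph hd hs0 hs1 Ω).topologicalClosure) : ‖z.fst‖ ≤ C * ‖z.snd‖ := by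
  have hsub : (gradGraph hd hs0 hs1 Ω : Set (MixedSpace Ω)) ⊆
      {z | ‖z.fst‖ ≤ C * ‖z.snd‖} := by
    rintro z ⟨φ, hφ, h1, h2⟩
    rw [Set.mem_ofPred_eq, Lp.norm_def, Lp.norm_def, eLpNorm_congr_ae h1, eLpNorm_congr_ae h2]
    exact hC.eLpNorm_le_fracGrad hd hs0 hs1 hφ
  exact closure_minimal hsub (isClosed_le
    (WithLp.fstL 2 ℝ (L2On Ω) (L2Vec d)).continuous.norm
    ((WithLp.sndL 2 ℝ (L2On Ω) (L2Vec d)).continuous.norm.const_mul C)) hz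

theorem integral_inner_eq_inner {Ψ Φ : L2Vec d} {u : E d → E d} (h : Φ =ᵐ[volume] u) :
    ∫ x, inner ℝ (u x) (Ψ x) = ⟪Φ, Ψ⟫ := by
  rw [L2.inner_def]
  refine integral_congr_ae ?_
  filter_upwards [h] with x hx
  rw [hx]

theorem integral_mul_eq_inner {a g : L2On Ω} {u : E d → ℝ} (h : a =ᵐ[volume.restrict Ω] u) :
    ∫ x in Ω, u x * g x = ⟪a, g⟫ := by
  rw [inner_L2On]
  refine integral_congr_ae ?_
  filter_upwards [h] with x hx
  rw [hx]

/-- Both sides are continuous in z, so the defining identity of the divergence extends from test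
functions to limits. This lets the variational solution be used as a test object. -/
theorem inner_snd_of_mem_closure (hd : 1 ≤ d) (hs0 : 0 < s) (hs1 : s < 1) {z : MixedSpace Ω}
    (hz : z ∈ (gradGraph hd hs0 hs1 Ω).topologicalClosure) {Ψ : L2Vec d} {g : L2On Ω}
    (hΨ : IsFracDivOn s Ω Ψ g) : ⟪z.snd, Ψ⟫ = -⟪z.fst, g⟫ := by
  have hsub : (gradGraph hd hs0 hs1 Ω : Set (MixedSpace Ω)) ⊆
      {z | ⟪z.snd, Ψ⟫ = -⟪z.fst, g⟫} := by
    rintro z ⟨φ, hφ, h1, h2⟩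
    rw [Set.mem_ofPred_eq, ← integral_inner_eq_inner h2, ← integral_mul_eq_inner h1]
    exact hΨ φ hφ
  exact closure_minimal hsub (isClosed_eq
    ((WithLp.sndL 2 ℝ (L2On Ω) (L2Vec d)).continuous.inner continuous_const)
    ((WithLp.fstL 2 ℝ (L2On Ω) (L2Vec d)).continuous.inner continuous_const).neg) hz

theorem isFracDivOn_of_forall_inner (hd : 1 ≤ d) (hs0 : 0 < s) (hs1 : s < 1) {Ψ : L2Vec d}
    {g : L2On Ω} (h : ∀ z ∈ gradGraph hd hs0 hs1 Ω, ⟪z.snd, Ψ⟫ = -⟪z.fst, g⟫) :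
    IsFracDivOn s Ω Ψ g := by
  intro φ hφ
  obtain ⟨z, hz, h1, h2⟩ := exists_mem_gradGraph hd hs0 hs1 hφ
  rw [integral_inner_eq_inner h2, integral_mul_eq_inner h1, h z hz]

theorem IsFracDivOn.sub (hd : 1 ≤ d) (hs0 : 0 < s) (hs1 : s < 1) {Ψ Φ : L2Vec d} {g h : L2On Ω}
    (hg : IsFracDivOn s Ω Ψ g) (hh : IsFracDivOn s Ω Φ h) : IsFracDivOn s Ω (Ψ - Φ) (g - h) := by
  refine isFracDivOn_of_forall_inner hd hs0 hs1 fun z hz => ?_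
  have hz' := (gradGraph hd hs0 hs1 Ω).le_topologicalClosure hz
  rw [inner_sub_right, inner_sub_right, inner_snd_of_mem_closure hd hs0 hs1 hz' hg,
    inner_snd_of_mem_closure hd hs0 hs1 hz' hh]
  ring

/-- The variational problem on the closure of the graph of the fractional gradient. -/
theorem exists_variational_solution (hd : 1 ≤ d) (hs0 : 0 < s) (hs1 : s < 1)
    (hP : ∃ C, IsPoincareConstant s Ω C) (f : L2On Ω) :
    ∃ z ∈ (gradGraph hd hs0 hs1 Ω).topologicalClosure,
      ∀ w ∈ (gradGraph hd hs0 hs1 Ω).topologicalClosure, ⟪z.snd, w.snd⟫ = ⟪f, w.fst⟫ := by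
  obtain ⟨C, hC⟩ := hP
  set S := (gradGraph hd hs0 hs1 Ω).topologicalClosure with hS
  have : CompleteSpace S := (Submodule.isClosed_topologicalClosure _).completeSpace_coe
  let P : S →L[ℝ] L2Vec d := (WithLp.sndL 2 ℝ (L2On Ω) (L2Vec d)).comp S.subtypeL
  let Q : S →L[ℝ] L2On Ω := (WithLp.fstL 2 ℝ (L2On Ω) (L2Vec d)).comp S.subtypeL
  let B : S →L[ℝ] S →L[ℝ] ℝ := (innerSL ℝ).bilinearComp P P
  have hB : IsCoercive B := by
    -- On the closure ‖u‖² = ‖u.fst‖² + ‖u.snd‖² ≤ (1 + C²) ‖u.snd‖².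
    refine ⟨(1 + C ^ 2)⁻¹, by positivity, fun u => ?_⟩
    have h1 : ‖(u : MixedSpace Ω).fst‖ ≤ C * ‖(u : MixedSpace Ω).snd‖ :=
      norm_fst_le_of_mem_closure hd hs0 hs1 hC u.2
    have h2 : B u u = ‖(u : MixedSpace Ω).snd‖ ^ 2 :=
      real_inner_self_eq_norm_sq (u : MixedSpace Ω).snd
    have h3 := WithLp.prod_norm_sq_eq_of_L2 (u : MixedSpace Ω)
    have h4 := pow_le_pow_left₀ (norm_nonneg _) h1 2
    rw [h2, mul_assoc, ← pow_two, inv_mul_le_iff₀ (by positivity), Submodule.coe_norm, h3]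
    linarith
  let ℓ : S →L[ℝ] ℝ := (innerSL ℝ f).comp Q
  let g : S := (InnerProductSpace.toDual ℝ S).symm ℓ
  let u : S := hB.continuousLinearEquivOfBilin.symm g
  refine ⟨u, u.2, fun w hw => ?_⟩
  have h5 := hB.continuousLinearEquivOfBilin_apply u ⟨w, hw⟩
  rw [show hB.continuousLinearEquivOfBilin u = g from
    hB.continuousLinearEquivOfBilin.apply_symm_apply g,
    InnerProductSpace.toDual_symm_apply] at h5
  exact h5.symm

/-- Take the variational solution with the sign of its gradient part reversed. Its bounds hold for
every Poincaré constant C, since ‖G‖² = ⟪f, p⟫ ≤ ‖f‖ C ‖G‖ for the gradient part G. The first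
assertion also says that div^s is onto L²(Ω). -/
theorem exists_mixed_solution (hd : 1 ≤ d) (hs0 : 0 < s) (hs1 : s < 1)
    (hP : ∃ C, IsPoincareConstant s Ω C) (f : L2On Ω) :
    ∃ (a : L2On Ω) (Φ : L2Vec d), IsFracDivOn s Ω Φ f ∧
      (∀ (Ψ : L2Vec d) (g : L2On Ω), IsFracDivOn s Ω Ψ g → ⟪Φ, Ψ⟫ = ⟪a, g⟫) ∧
      ∀ C, IsPoincareConstant s Ω C → ‖a‖ ≤ C ^ 2 * ‖f‖ ∧ ‖Φ‖ ≤ C * ‖f‖ := by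
  obtain ⟨z, hz, h⟩ := exists_variational_solution hd hs0 hs1 hP f
  refine ⟨z.fst, -z.snd, ?_, ?_, ?_⟩
  · refine isFracDivOn_of_forall_inner hd hs0 hs1 fun w hw => ?_
    rw [inner_neg_right, real_inner_comm, h w ((gradGraph hd hs0 hs1 Ω).le_topologicalClosure hw),
      real_inner_comm]
  · intro Ψ g hΨ
    rw [inner_neg_left, inner_snd_of_mem_closure hd hs0 hs1 hz hΨ, neg_neg]
  · intro C hC
    have h1 := norm_fst_le_of_mem_closure hd hs0 hs1 hC hz
    have h2 : ‖z.snd‖ ^ 2 ≤ ‖f‖ * ‖z.fst‖ := by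
      rw [← real_inner_self_eq_norm_sq, h z hz]
      exact real_inner_le_norm _ _
    have h3 : ‖z.snd‖ ≤ C * ‖f‖ := by
      rcases (norm_nonneg z.snd).eq_or_lt with h0 | h0
      · rw [← h0]
        exact mul_nonneg hC.1 (norm_nonneg _)
      · refine le_of_mul_le_mul_right ?_ h0
        calc ‖z.snd‖ * ‖z.snd‖ ≤ ‖f‖ * ‖z.fst‖ := by rw [← pow_two]; exact h2
          _ ≤ ‖f‖ * (C * ‖z.snd‖) := by gcongr
          _ = _ := by ring
    refine ⟨h1.trans ?_, by rwa [norm_neg]⟩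
    calc C * ‖z.snd‖ ≤ C * (C * ‖f‖) := mul_le_mul_of_nonneg_left h3 hC.1
      _ = _ := by ring

theorem fracDivOn_eq (hΩ : IsOpen Ω) {Ψ : L2Vec d} {g : L2On Ω} (h : IsFracDivOn s Ω Ψ g) :
    fracDivOn s Ω Ψ = g :=
  (isFracDivOn_fracDivOn ⟨g, h⟩).unique hΩ h

theorem isFracDivOn_zero : IsFracDivOn s Ω (0 : L2Vec d) 0 := by
  intro φ _
  have h1 : ∫ x, inner ℝ (fracGrad s φ x) ((0 : L2Vec d) x) = 0 := by
    refine integral_eq_zero_of_ae ?_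
    filter_upwards [Lp.coeFn_zero (E d) 2 (volume : Measure (E d))] with x hx
    change inner ℝ (fracGrad s φ x) ((0 : L2Vec d) x) = 0
    rw [hx, Pi.zero_apply, inner_zero_right]
  have h2 : ∫ x in Ω, φ x * (0 : L2On Ω) x = 0 := by
    refine integral_eq_zero_of_ae ?_
    filter_upwards [Lp.coeFn_zero ℝ 2 (volume.restrict Ω)] with x hx
    change φ x * (0 : L2On Ω) x = 0
    rw [hx, Pi.zero_apply, mul_zero]
  rw [h1, h2, neg_zero]

/-- A weak solution solves `div^s Φ = f` and `Φ = -grad^s p` in the weak sense. -/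
theorem isWeakSolution_iff (hΩ : IsOpen Ω) {f a : L2On Ω} {p : L2 d} {Φ : L2Vec d}
    (ha : a =ᵐ[volume.restrict Ω] p) :
    IsWeakSolution s Ω f p Φ ↔ p ∈ TildeL2 Ω ∧ IsFracDivOn s Ω Φ f ∧
      ∀ (Ψ : L2Vec d) (g : L2On Ω), IsFracDivOn s Ω Ψ g → ⟪Φ, Ψ⟫ = ⟪a, g⟫ := by
  have hΦΨ : ∀ Ψ : L2Vec d, ∫ x, inner ℝ (Φ x) (Ψ x) = ⟪Φ, Ψ⟫ := fun Ψ =>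
    integral_inner_eq_inner (Filter.EventuallyEq.refl _ _)
  constructor
  · rintro ⟨hp, hΦ, h⟩
    have hdiv : fracDivOn s Ω Φ = f := by
      -- Testing with Ψ = 0 and q the residual div^s Φ - f makes the norm of the residual vanish.
      obtain ⟨q, hq, hqa, -⟩ := exists_extension_by_zero hΩ.measurableSet (fracDivOn s Ω Φ - f)
      have h0 := h q hq 0 ⟨0, isFracDivOn_zero⟩
      rw [hΦΨ, inner_zero_right, fracDivOn_eq hΩ isFracDivOn_zero, integral_mul_eq_inner ha,
        inner_zero_right, integral_mul_eq_inner hqa.symm] at h0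
      simp_rw [mul_comm (f _)] at h0
      rw [integral_mul_eq_inner hqa.symm, sub_zero, zero_add] at h0
      rw [← sub_eq_zero, ← inner_self_eq_zero (𝕜 := ℝ), inner_sub_right, h0, sub_self]
    refine ⟨hp, hdiv ▸ isFracDivOn_fracDivOn hΦ, fun Ψ g hg => ?_⟩
    -- Testing with q = 0 isolates the other equation.
    obtain ⟨q, hq, hqa, -⟩ := exists_extension_by_zero hΩ.measurableSet (0 : L2On Ω)
    have h0 := h q hq Ψ ⟨g, hg⟩
    rw [hΦΨ, fracDivOn_eq hΩ hg, integral_mul_eq_inner ha, integral_mul_eq_inner hqa.symm,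
      inner_zero_left] at h0
    simp_rw [mul_comm (f _)] at h0
    rw [integral_mul_eq_inner hqa.symm, inner_zero_left] at h0
    linarith
  · rintro ⟨hp, hΦ, h⟩
    refine ⟨hp, ⟨f, hΦ⟩, fun q _ Ψ hΨ => ?_⟩
    rw [hΦΨ, integral_mul_eq_inner ha, h Ψ _ (isFracDivOn_fracDivOn hΨ), fracDivOn_eq hΩ hΦ,
      sub_self, zero_add]
    simp_rw [mul_comm (f _)]

theorem exists_isWeakSolution (hd : 1 ≤ d) (hs0 : 0 < s) (hs1 : s < 1) (hΩ : IsOpen Ω)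
    (hP : ∃ C, IsPoincareConstant s Ω C) (f : L2On Ω) :
    ∃ (p : L2 d) (Φ : L2Vec d), IsWeakSolution s Ω f p Φ ∧
      ∀ C, IsPoincareConstant s Ω C → ‖p‖ ≤ C ^ 2 * ‖f‖ ∧ ‖Φ‖ ≤ C * ‖f‖ := by
  obtain ⟨a, Φ, h1, h2, h3⟩ := exists_mixed_solution hd hs0 hs1 hP f
  obtain ⟨p, hp, hpa, hn⟩ := exists_extension_by_zero hΩ.measurableSet a
  exact ⟨p, Φ, (isWeakSolution_iff hΩ hpa.symm).2 ⟨hp, h1, h2⟩, hn ▸ h3⟩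

/-- The difference of the fluxes is divergence free, so both flux equations tested with it have
right side zero, and it is orthogonal to itself. The difference of the pressures is then orthogonal
to every divergence. -/
theorem IsWeakSolution.unique (hd : 1 ≤ d) (hs0 : 0 < s) (hs1 : s < 1) (hΩ : IsOpen Ω)
    (hP : ∃ C, IsPoincareConstant s Ω C) {f : L2On Ω} {p q : L2 d} {Φ Ψ : L2Vec d}
    (h1 : IsWeakSolution s Ω f p Φ) (h2 : IsWeakSolution s Ω f q Ψ) : p = q ∧ Φ = Ψ := by
  have hr := LpToLpRestrictCLM_coeFn (F := ℝ) (p := 2) (μ := (volume : Measure (E d))) ℝ Ω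
  obtain ⟨hp, hΦ, h1⟩ := (isWeakSolution_iff hΩ (hr p)).1 h1
  obtain ⟨hq, hΨ, h2⟩ := (isWeakSolution_iff hΩ (hr q)).1 h2
  have hdiff := hΦ.sub hd hs0 hs1 hΨ
  rw [sub_self] at hdiff
  have hΦΨ : Φ = Ψ := by
    rw [← sub_eq_zero, ← inner_self_eq_zero (𝕜 := ℝ), inner_sub_left, h1 _ _ hdiff, h2 _ _ hdiff,
      inner_zero_right, inner_zero_right, sub_self]
  refine ⟨ae_eq_of_mem_tildeL2 hΩ.measurableSet hp hq ?_, hΦΨ⟩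
  set a := LpToLpRestrictCLM (E d) ℝ ℝ volume 2 Ω p
  set b := LpToLpRestrictCLM (E d) ℝ ℝ volume 2 Ω q
  -- A field whose divergence is a - b itself, by surjectivity.
  obtain ⟨-, Θ, hΘ, -⟩ := exists_mixed_solution hd hs0 hs1 hP (a - b)
  have hab : a = b := by
    rw [← sub_eq_zero, ← inner_self_eq_zero (𝕜 := ℝ), inner_sub_left, ← h1 _ _ hΘ, ← h2 _ _ hΘ,
      hΦΨ, sub_self]
  have h3 := hr q
  change b =ᵐ[volume.restrict Ω] q at h3
  rw [← hab] at h3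
  exact (hr p).symm.trans h3

end Mixed

end FracDarcy

/-! ### Well-posedness and the stability bounds -/

theorem mainTheorem2 (d : ℕ) (hd : 1 ≤ d) (s : ℝ) (hs0 : 0 < s) (hs1 : s < 1)
    (Ω : Set (FracDarcy.E d)) (hΩo : IsOpen Ω) (hΩb : Bornology.IsBounded Ω)
    (hΩL : FracDarcy.HasLipschitzBoundary Ω) :
    (∃ C : ℝ, FracDarcy.IsPoincareConstant s Ω C) ∧
    ∀ f : FracDarcy.L2On Ω,
      (∃! x : FracDarcy.L2 d × FracDarcy.L2Vec d, FracDarcy.IsWeakSolution s Ω f x.1 x.2) ∧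
      ∀ (p : FracDarcy.L2 d) (Φ : FracDarcy.L2Vec d), FracDarcy.IsWeakSolution s Ω f p Φ →
        ∀ C : ℝ, FracDarcy.IsPoincareConstant s Ω C →
          ‖p‖ ≤ 2 * (1 + C ^ 2) * ‖f‖ ∧
          FracDarcy.hdivNorm s Ω Φ ≤ 2 * Real.sqrt (1 + C ^ 2) * ‖f‖ := by
  have hP := FracDarcy.exists_isPoincareConstant hd hs0 hs1 hΩo hΩb
  refine ⟨hP, fun f => ?_⟩
  obtain ⟨p₀, Φ₀, hsol, hbound⟩ := FracDarcy.exists_isWeakSolution hd hs0 hs1 hΩo hP f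
  refine ⟨⟨(p₀, Φ₀), hsol, fun y hy => ?_⟩, fun p Φ h C hC => ?_⟩
  · obtain ⟨h1, h2⟩ := hy.unique hd hs0 hs1 hΩo hP hsol
    exact Prod.ext h1 h2
  · obtain ⟨rfl, rfl⟩ := h.unique hd hs0 hs1 hΩo hP hsol
    obtain ⟨h1, h2⟩ := hbound C hC
    have hf := norm_nonneg f
    refine ⟨h1.trans (by gcongr; nlinarith [sq_nonneg C]), ?_⟩
    have hdiv := ((FracDarcy.isWeakSolution_iff hΩo
      (LpToLpRestrictCLM_coeFn (F := ℝ) (p := 2) (μ := volume) ℝ Ω p)).1 h).2.1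
    rw [FracDarcy.hdivNorm, FracDarcy.fracDivOn_eq hΩo hdiv]
    refine Real.sqrt_le_iff.2 ⟨by positivity, ?_⟩
    rw [mul_pow, mul_pow, Real.sq_sqrt (by positivity)]
    -- As div^s Φ = f, the squared norm is at most (C² + 1) ‖f‖²; the factor 2 in the claim is
    -- slack.
    have h3 := pow_le_pow_left₀ (norm_nonneg _) h2 2
    nlinarith [mul_nonneg (sq_nonneg C) (sq_nonneg ‖f‖), sq_nonneg ‖f‖]
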